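/- **Model.** Consider $N$ links in slotted time $t\in\{0,1,2,\dots\}$. In slot $t$, $A_i(t)\in\{0,1,2,\dots\}$ packets arrive to queue $i$ and channel $i$ has state $S_i(t)\in\{0,1\}$. The $A_i(t)$ are independent over $i$ and i.i.d. over $t$, with mean $\lambda_i$ and finite second moment; the $S_i(t)$ are independent over $i$ and i.i.d. over $t$, with $\Pr[S_i(t)=1]=p_i$; arrivals and channels are independent of each other. In every slot a causal, possibly randomized, policy observes the backlogs and the channel states and selects at most one link; the rate vector $\mu(t)$ has $\mu_i(t)=S_i(t)$ if link $i$ is selected and $\mu_i(t)=0$ otherwise. The queues evolve by $Q_i(t+1)=\max[Q_i(t)-\mu_i(t),0]+A_i(t)$, where $Q(0)$ is independent of all arrivals and channels and has finite second moments. The capacity region $\Lambda$ is the closure of the set of rate vectors $\lambda$ for which some policy makes all queues strongly stable, i.e. $\limsup_{t\to\infty}\frac1t\sum_{\tau<t}E[Q_i(\tau)]<\infty$ for all $i$. The max-weight policy (Longest Connected Queue, LCQ) selects in every slot a link with the largest product $Q_i(t)S_i(t)$, ties being broken in any causal, possibly randomized, way. Write $\lambda_{tot}=\sum_i\lambda_i$,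 $A_{tot}(t)=\sum_iA_i(t)$, $p_{min}=\min_ip_i$, $D=\frac12\big[\lambda_{tot}+E[A_{tot}(t)^2]\big]$, and $$\overline Q_{tot}=\limsup_{t\to\infty}\frac1t\sum_{\tau<t}\sum_iE[Q_i(\tau)],\qquad \overline W=\limsup_{t\to\infty}\frac{E[\text{total delay of all packets arriving in slots }0,\dots,t-1]}{E[\text{number of packets arriving in slots }0,\dots,t-1]},$$ where every queue is first come first served and the delay of a packet is the number of slots $\tau$ at which it is counted in the backlog $Q_i(\tau)$. Statements about $\overline W$ are for $\lambda_{tot}>0$. **Theorem (delay bound for ON/OFF channels with $f$-balanced traffic).** Let $0<\rho<1$ and $\lambda\in\rho\Lambda$, and let LCQ be used. Suppose that there is a smallest integer $K\ge0$ with $1-(1-p_{min})^K\ge(1+\rho)/2$ (this holds exactly if $p_{min}>0$, and then $K\ge1$), and that $K\le N$. Let $\hat N=\lceil N/K\rceil K$ and $z=(1-1/K)/(1-1/\hat N)$, with $z=0$ if $K=1$. 1. If $\beta\ge0$ satisfies $z\beta<\frac12$ (that is, $\beta<1/(2z)$ if $z>0$) and $$\lambda_i\le\frac{\lambda_{tot}}{\hat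 N}+\frac{\beta(1-\rho)}{K}\quad\text{for all }i,\tag{$*$}$$ then $$\overline Q_{tot}\le\frac{KD}{(1-\rho)(\frac12-z\beta)},\qquad \overline W\le\frac{K(D/\lambda_{tot})}{(1-\rho)(\frac12-z\beta)}.$$ 2. If $N$ is a multiple of $K$ and all $A_i(t)$ are Poisson with the same mean $\lambda_i=\lambda_{tot}/N$, then $(*)$ holds with $\beta=0$ and $$\overline Q_{tot}\le\frac{2K\lambda_{tot}-\lambda_{tot}^2}{1-\rho},\qquad \overline W\le\frac{2K-\lambda_{tot}}{1-\rho}.$$ 3. Consequently the delay is $O\big(\log(\frac1{1-\rho})/(1-\rho)\big)$, uniformly in $N$: for all reals $p_0,\rho_0,\delta>0$ and $M$ there is a constant $c$, depending only on them, such that in every system as in part 1 with $p_{min}\ge p_0$, $\rho\ge\rho_0$, $z\beta\le\frac12-\delta$, $\lambda_{tot}>0$ and $\sum_iE[A_i(t)^2]\le M\lambda_{tot}$, $$\overline W\le c\,\frac{\log(1/(1-\rho))}{1-\rho}.$$ -/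

import Mathlib

open MeasureTheory ProbabilityTheory Filter Topology
open scoped ENNReal Pointwise

universe u

/-- The feasibility set of a slot with channel states `s`: at most one link `i` is selected, the
selected link transmits at rate `s i`, and every other link at rate `0`. -/
def feasibleSet {N : ℕ} (s : Fin N → ℕ) : Set (Fin N → ℕ) :=
  {m | m = 0 ∨ ∃ i, m = Pi.single i (s i)}

/-- A slotted system with `N` ON/OFF links, ON probabilities `p` and arrival rates `lam`, on the
probability space `(Ω, P)`, under some causal, possibly randomized, control policy.
`init` is the backlog at time `0`, `arr t` the vector of arrivals, `chan t` the vector of channel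
states and `mu t` the chosen transmission rate vector of slot `t`. -/
structure OnOffSystem {Ω : Type*} [MeasurableSpace Ω] (P : Measure Ω) {N : ℕ}
    (p lam : Fin N → ℝ) where
  init : Ω → Fin N → ℕ
  arr : ℕ → Ω → Fin N → ℕ
  chan : ℕ → Ω → Fin N → ℕ
  mu : ℕ → Ω → Fin N → ℕ
  measurable_init : Measurable init
  measurable_arr : ∀ t, Measurable (arr t)
  measurable_chan : ∀ t, Measurable (chan t)
  measurable_mu : ∀ t, Measurable (mu t)
  /-- The initial backlogs have finite second moments. -/
  memLp_init : ∀ i, MemLp (fun ω => (init ω i : ℝ)) 2 P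
  /-- Arrivals: identically distributed over slots, independent over links, with mean `lam i` and
  finite second moment. -/
  identDistrib_arr : ∀ t i, IdentDistrib (fun ω => arr t ω i) (fun ω => arr 0 ω i) P P
  iIndepFun_arr : ∀ t, iIndepFun (fun i ω => arr t ω i) P
  memLp_arr : ∀ i, MemLp (fun ω => (arr 0 ω i : ℝ)) 2 P
  mean_arr : ∀ i, ∫ ω, (arr 0 ω i : ℝ) ∂P = lam i
  /-- Channels: Bernoulli with parameter `p i`, independent over links. -/
  chan_le_one : ∀ t ω i, chan t ω i ≤ 1
  prob_chan : ∀ t i, P.real {ω | chan t ω i = 1} = p i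
  iIndepFun_chan : ∀ t, iIndepFun (fun i ω => chan t ω i) P
  /-- The channel states of slot `t` are independent of the whole history before slot `t`. -/
  indep_chan : ∀ t, IndepFun
    (fun ω => (init ω, fun s : Fin t => (arr s ω, chan s ω, mu s ω))) (chan t) P
  /-- The arrivals of slot `t` are independent of the history before slot `t`, of the channel
  states of slot `t` and of the decision of slot `t`. -/
  indep_arr : ∀ t, IndepFun
    (fun ω => ((init ω, fun s : Fin t => (arr s ω, chan s ω, mu s ω)), chan t ω, mu t ω))
    (arr t) P
  mu_feasible : ∀ t ω, mu t ω ∈ feasibleSet (chan t ω)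

namespace OnOffSystem

variable {Ω : Type*} [MeasurableSpace Ω] {P : Measure Ω} {N : ℕ} {p lam : Fin N → ℝ}

/-- The backlogs: `Q i (t+1) = max (Q i t - mu i t) 0 + A i t`. The subtraction of natural numbers
is truncated at `0`, which is the maximum with `0`. -/
def queue (X : OnOffSystem P p lam) : ℕ → Ω → Fin N → ℕ
  | 0, ω, i => X.init ω i
  | t + 1, ω, i => (queue X t ω i - X.mu t ω i) + X.arr t ω i

/-- Strong stability of all queues. -/
def StronglyStable (X : OnOffSystem P p lam) : Prop :=
  ∀ i, limsup (fun t : ℕ =>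
    (∑ τ ∈ Finset.range t, ∫⁻ ω, (X.queue τ ω i : ℝ≥0∞) ∂P) / (t : ℝ≥0∞)) atTop < ∞

/-- The max-weight (Longest Connected Queue) policy: in every slot a link with the largest product
of backlog and channel state is served; ties may be broken in any causal, possibly randomized
way. -/
def IsLCQ (X : OnOffSystem P p lam) : Prop :=
  ∀ t ω, ∃ i, X.mu t ω = Pi.single i (X.chan t ω i) ∧
    ∀ j, X.queue t ω j * X.chan t ω j ≤ X.queue t ω i * X.chan t ω i

/-- The long-term average total backlog. -/
noncomputable def avgBacklog (X : OnOffSystem P p lam) : ℝ≥0∞ :=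
  limsup (fun t : ℕ =>
    (∑ τ ∈ Finset.range t, ∫⁻ ω, ∑ i, (X.queue τ ω i : ℝ≥0∞) ∂P) / (t : ℝ≥0∞)) atTop

/-- Number of packets of link `i` that have entered its queue before slot `t`, those present at
time `0` included. -/
def entered (X : OnOffSystem P p lam) (t : ℕ) (ω : Ω) (i : Fin N) : ℕ :=
  X.init ω i + ∑ τ ∈ Finset.range t, X.arr τ ω i

/-- Number of packets of link `i` that have been transmitted before slot `t`. -/
def departed (X : OnOffSystem P p lam) (t : ℕ) (ω : Ω) (i : Fin N) : ℕ :=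
  ∑ τ ∈ Finset.range t, min (X.mu τ ω i) (X.queue τ ω i)

/-- Delay of the `n`-th packet of link `i` (counted from `0` in order of entrance, first come
first served): the number of slots `t` at which the packet is waiting in the queue. -/
noncomputable def delay (X : OnOffSystem P p lam) (i : Fin N) (n : ℕ) (ω : Ω) : ℝ≥0∞ :=
  ∑' t : ℕ, if X.departed t ω i ≤ n ∧ n < X.entered t ω i then 1 else 0

/-- The long-term average delay per packet: the expected sum of the (complete) delays of all
packets that arrive in the first `t` slots, divided by the expected number of these packets, as
`t` tends to infinity. -/
noncomputable def avgDelay (X : OnOffSystem P p lam) : ℝ≥0∞ :=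
  limsup (fun t : ℕ =>
    (∑ s ∈ Finset.range t, ∑ i, ∫⁻ ω,
        ∑ n ∈ Finset.Ico (X.entered s ω i) (X.entered (s + 1) ω i), X.delay i n ω ∂P) /
      (∑ s ∈ Finset.range t, ∑ i, ∫⁻ ω, (X.arr s ω i : ℝ≥0∞) ∂P)) atTop

/-- The constant `D = (λ_tot + E[A_tot ^ 2]) / 2`. -/
noncomputable def constD (X : OnOffSystem P p lam) : ℝ :=
  (1 / 2) * ((∑ i, lam i) + ∫ ω, (∑ i, (X.arr 0 ω i : ℝ)) ^ 2 ∂P)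

end OnOffSystem

/-- The network capacity region: the closure of the set of all rate vectors for which some control
policy makes all queues strongly stable. -/
def capacityRegion {N : ℕ} (p : Fin N → ℝ) : Set (Fin N → ℝ) :=
  closure {lam | ∃ (Ω : Type) (_ : MeasurableSpace Ω) (P : Measure Ω)
    (_ : IsProbabilityMeasure P) (X : OnOffSystem P p lam), X.StronglyStable}

/-- The smallest ON probability. -/
noncomputable def pMin {N : ℕ} (p : Fin N → ℝ) : ℝ := ⨅ i, p i

/-- `K` is the smallest integer with `1 - (1 - p_min) ^ K ≥ (1 + ρ) / 2`. -/
def IsGroupNumber {N : ℕ} (p : Fin N → ℝ) (ρ : ℝ) (K : ℕ) : Prop :=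
  IsLeast {k : ℕ | (1 + ρ) / 2 ≤ 1 - (1 - pMin p) ^ k} K

/-- The smallest multiple of `K` that is at least `N`. -/
noncomputable def hatN (N K : ℕ) : ℕ := ⌈(N : ℝ) / (K : ℝ)⌉₊ * K

/-- The constant `z = (1 - 1 / K) / (1 - 1 / hatN)`; it is `0` if `K = 1`. -/
noncomputable def zConst (N K : ℕ) : ℝ := (1 - 1 / (K : ℝ)) / (1 - 1 / (hatN N K : ℝ))

/-- The `f`-balanced traffic constraints with `f = β (1 - ρ) / K`. -/
def IsBalanced {N : ℕ} (lam : Fin N → ℝ) (ρ : ℝ) (K : ℕ) (β : ℝ) : Prop :=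
  ∀ i, lam i ≤ (∑ j, lam j) / (hatN N K : ℝ) + β * (1 - ρ) / (K : ℝ)

/-! ### Constants of the queue grouping -/

/-! Write r_k = 1 - (1 - p_min)^k and z = `zConst N K`. Pad the links with empty ones up to `hatN N
K` and split them at random into K groups of equal size. Two distinct links then share a group with
probability 1 - z, so `gram z x x` is the expected sum of squared group backlogs. Half of this form
is the Lyapunov function.

Backlog. When LCQ transmits, the form falls to first order by `servedWeight`, whose mean is at least
(r_K / K) ∑ q_i (`le_integral_servedWeight`). To see this, slice the backlogs into unit layers. A
layer met by k links contributes (z + (1 - z) k) times the indicator that one of those links is ON,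
and `layer_bound` compares its mean with k r_K / K. Arrivals raise the form at the rate `gram z q
lam`. Since λ_tot ≤ ρ, balanced traffic makes every coefficient z λ_i + (1 - z) λ_tot at most r_K /
K - ε with ε = (1 - ρ)(1/2 - zβ)/K (`IsBalanced.weight_add_le`). The drift is therefore at most C -
ε ∑ q_i, and telescoping bounds the average backlog by C / ε (`sum_lintegral_queue_le`). A linear
correction term in the Lyapunov function replaces the number of transmissions by the arrival rate,
which gives the sharp C. Of the capacity region only the outer bound ∑ λ_i ≤ 1 is needed.

Delay. The packets arriving before slot t may wait beyond t, so Little's theorem needs their total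
sojourn after t to be o(t). No stationarity is used. Instead there is a function Ψ of linear growth
with mean change at most -η off the empty state (`exists_isDriftFunction`): the square root of the
form handles large states, and a bounded term Γ(1 - θ^(∑ q_i)) handles the finitely many small ones.
If R is the number of old packets still present, R Ψ(Q) loses at least η R per slot on average, so
the total sojourn after t is at most a constant times E[Ψ(Q(t))²]
(`IsDriftFunction.tsum_residual_le`). That moment is o(t), although arrivals have only second
moments, by the drift of the truncated square ((Ψ - M)⁺)² and M → ∞
(`IsDriftFunction.tendsto_sq_div`).

The logarithmic delay bound then follows from K = O(log(1/(1 - ρ))) (`IsGroupNumber.le_log`). -/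

theorem le_hatN {N K : ℕ} (hK : 1 ≤ K) : N ≤ hatN N K := by
  have hK' : (0 : ℝ) < K := by exact_mod_cast hK
  have h : (N : ℝ) / K ≤ (⌈(N : ℝ) / (K : ℝ)⌉₊ : ℝ) := Nat.le_ceil _
  rw [div_le_iff₀ hK'] at h
  unfold hatN
  exact_mod_cast h

theorem hatN_of_dvd {N K : ℕ} (hK : 1 ≤ K) (h : K ∣ N) : hatN N K = N := by
  obtain ⟨m, rfl⟩ := h
  have hK' : (K : ℝ) ≠ 0 := by exact_mod_cast (by omega : K ≠ 0)
  unfold hatN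
  rw [Nat.cast_mul, mul_div_cancel_left₀ _ hK', Nat.ceil_natCast, mul_comm]

theorem zConst_mul {N K : ℕ} (hK : 1 ≤ K) (hN : K ≤ N) :
    zConst N K * (1 - 1 / (hatN N K : ℝ)) = 1 - 1 / (K : ℝ) := by
  unfold zConst
  -- The degenerate case `hatN N K = 1` forces `K = 1`, and then both sides are 0, whatever value
  -- the division by zero has.
  by_cases h : (1 - 1 / (hatN N K : ℝ)) = 0
  · have h0 : (0 : ℝ) < hatN N K := by
      have := le_hatN (N := N) hK
      exact_mod_cast (by omega : 0 < hatN N K)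
    have h1 : (hatN N K : ℝ) = 1 := by field_simp at h; linarith
    have h2 : hatN N K = 1 := by exact_mod_cast h1
    have h3 : K = 1 := by have := le_hatN (N := N) hK; omega
    simp [h3]
  · field_simp

theorem zConst_nonneg {N K : ℕ} (hK : 1 ≤ K) (hN : K ≤ N) : 0 ≤ zConst N K := by
  have h1 : (1 : ℝ) ≤ K := by exact_mod_cast hK
  have h2 : (1 : ℝ) ≤ hatN N K := by exact_mod_cast (hK.trans hN).trans (le_hatN hK)
  have h3 : 1 / (K : ℝ) ≤ 1 := by rw [div_le_one (by linarith)]; exact h1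
  have h4 : 1 / (hatN N K : ℝ) ≤ 1 := by rw [div_le_one (by linarith)]; exact h2
  exact div_nonneg (by linarith) (by linarith)

theorem zConst_le_one {N K : ℕ} (hK : 1 ≤ K) (hN : K ≤ N) : zConst N K ≤ 1 := by
  have h1 : (1 : ℝ) ≤ K := by exact_mod_cast hK
  have h2 : (K : ℝ) ≤ hatN N K := by exact_mod_cast hN.trans (le_hatN hK)
  have h4 : 1 / (hatN N K : ℝ) ≤ 1 := by rw [div_le_one (by linarith)]; linarith
  have h5 : 1 / (hatN N K : ℝ) ≤ 1 / K := one_div_le_one_div_of_le (by linarith) h2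
  exact div_le_one_of_le₀ (by linarith) (by linarith)

/-- This is the defining property of z: a given link and a uniformly chosen one of the `hatN N K`
links, possibly the same, lie in a common group with probability 1/K. -/
theorem zConst_div_add {N K : ℕ} (hK : 1 ≤ K) (hN : K ≤ N) :
    zConst N K / hatN N K + (1 - zConst N K) = 1 / K := by
  have := zConst_mul hK hN
  rw [div_eq_mul_one_div]
  linarith

/-- The right side is the sum of p(1 - p)^j over j < k, and each term is at least p(1 - p)^K. -/
theorem mul_pow_le_one_sub_pow {p : ℝ} (h0 : 0 ≤ p) (h1 : p ≤ 1) {k K : ℕ} (h : k ≤ K) :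
    k * p * (1 - p) ^ K ≤ 1 - (1 - p) ^ k := by
  induction k with
  | zero => simp
  | succ k ih =>
    have h2 := ih (by omega)
    have h3 : (1 - p) ^ K ≤ (1 - p) ^ k :=
      pow_le_pow_of_le_one (by linarith) (by linarith) (by omega)
    have h4 := mul_le_mul_of_nonneg_left h3 h0
    rw [pow_succ]
    push_cast
    linarith

/-- Concavity of `k ↦ 1 - (1 - p) ^ k`. -/
theorem mul_one_sub_pow_le {p : ℝ} (h0 : 0 ≤ p) (h1 : p ≤ 1) {k K : ℕ} (h : k ≤ K) :
    k * (1 - (1 - p) ^ K) ≤ K * (1 - (1 - p) ^ k) := by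
  induction K, h using Nat.le_induction with
  | base => exact le_rfl
  | succ K hK ih =>
    have := mul_pow_le_one_sub_pow h0 h1 hK
    rw [pow_succ]
    push_cast
    linarith

/-- For k ≤ K the first factor on the right is at least 1 and concavity of k ↦ r_k suffices. For k ≥
K monotonicity gives r_K ≤ r_k, and k ≤ `hatN N K` gives k/K = z k / `hatN N K` + (1 - z) k ≤ z + (1
- z) k. -/
theorem layer_bound {N K : ℕ} (hK : 1 ≤ K) (hN : K ≤ N) {p : ℝ} (h0 : 0 ≤ p) (h1 : p ≤ 1)
    {k : ℕ} (hk : k ≤ N) :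
    k * ((1 - (1 - p) ^ K) / K) ≤
      (zConst N K + (1 - zConst N K) * k) * (1 - (1 - p) ^ k) := by
  have hK0 : (0 : ℝ) < K := by exact_mod_cast hK
  have hz0 := zConst_nonneg hK hN
  have hz1 := zConst_le_one hK hN
  have hrK : 0 ≤ 1 - (1 - p) ^ K := by
    have := pow_le_one₀ (n := K) (by linarith : 0 ≤ 1 - p) (by linarith)
    linarith
  have hrk : 0 ≤ 1 - (1 - p) ^ k := by
    have := pow_le_one₀ (n := k) (by linarith : 0 ≤ 1 - p) (by linarith)
    linarith
  rcases Nat.eq_zero_or_pos k with rfl | hkpos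
  · simp
  have hk1 : (1 : ℝ) ≤ k := by exact_mod_cast hkpos
  rcases le_total k K with h | h
  · have h2 := mul_one_sub_pow_le h0 h1 h
    have h3 : k * ((1 - (1 - p) ^ K) / K) ≤ 1 - (1 - p) ^ k := by
      rw [← mul_div_assoc, div_le_iff₀ hK0]
      linarith
    refine h3.trans (le_mul_of_one_le_left hrk ?_)
    nlinarith
  · have h2 : 1 - (1 - p) ^ K ≤ 1 - (1 - p) ^ k := by
      have := pow_le_pow_of_le_one (by linarith : 0 ≤ 1 - p) (by linarith) h
      linarith
    have h3 : (k : ℝ) * (1 / K) ≤ zConst N K + (1 - zConst N K) * k := by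
      rw [← zConst_div_add hK hN]
      have h4 : (k : ℝ) ≤ hatN N K := by exact_mod_cast hk.trans (le_hatN hK)
      have h5 : zConst N K * (k / hatN N K) ≤ zConst N K * 1 :=
        mul_le_mul_of_nonneg_left (div_le_one_of_le₀ h4 (by linarith)) hz0
      have h6 : (k : ℝ) * (zConst N K / hatN N K) = zConst N K * (k / hatN N K) := by ring
      linarith
    calc k * ((1 - (1 - p) ^ K) / K) = k * (1 / K) * (1 - (1 - p) ^ K) := by ring
      _ ≤ k * (1 / K) * (1 - (1 - p) ^ k) := by gcongr
      _ ≤ _ := by gcongr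

/-! ### The quadratic form of the Lyapunov function and the weight served by LCQ -/

section Quadratic

variable {N : ℕ}

/-- The average over all groupings of the inner product of group backlogs. -/
def gram (z : ℝ) (x y : Fin N → ℝ) : ℝ :=
  z * ∑ i, x i * y i + (1 - z) * ((∑ i, x i) * ∑ i, y i)

/-- A vector of natural numbers as a real vector. -/
def castVec (q : Fin N → ℕ) : Fin N → ℝ := fun i => q i

/-- The largest product of backlog and channel state. -/
def maxConn (q s : Fin N → ℕ) : ℕ := Finset.univ.sup fun j => q j * s j

/-- The drift caused by the service of a longest connected queue. -/
def servedWeight (z : ℝ) (q s : Fin N → ℕ) : ℝ :=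
  z * maxConn q s + (1 - z) * ((∑ i, (q i : ℝ)) * (min (maxConn q s) 1 : ℕ))

/-- `m` is the rate vector of a longest connected queue. -/
def IsLongestConnected (q s m : Fin N → ℕ) : Prop :=
  ∃ i, m = Pi.single i (s i) ∧ ∀ j, q j * s j ≤ q i * s i

theorem exists_isLongestConnected (hN : 0 < N) (q s : Fin N → ℕ) :
    ∃ m, IsLongestConnected q s m := by
  have : Nonempty (Fin N) := ⟨⟨0, hN⟩⟩
  obtain ⟨i, hi⟩ := Finite.exists_max fun j => q j * s j
  exact ⟨_, i, rfl, hi⟩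

/-- A longest connected queue transmits one packet whenever some nonempty queue is connected. -/
theorem IsLongestConnected.sub_eq {q s m : Fin N → ℕ} (h : IsLongestConnected q s m)
    (hs : ∀ i, s i ≤ 1) : ∃ i, castVec (q - m) = castVec q - Pi.single i ((min (maxConn q s) 1 : ℕ) : ℝ)
      ∧ (q i : ℝ) * (min (maxConn q s) 1 : ℕ) = maxConn q s := by
  obtain ⟨i, rfl, hi⟩ := h
  have hM : maxConn q s = q i * s i :=
    le_antisymm (Finset.sup_le fun j _ => hi j)
      (Finset.le_sup (f := fun j => q j * s j) (Finset.mem_univ i))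
  refine ⟨i, ?_, ?_⟩
  · ext j
    simp only [castVec, Pi.sub_apply]
    by_cases hj : j = i
    · subst hj
      simp only [Pi.single_eq_same, hM]
      rcases Nat.le_one_iff_eq_zero_or_eq_one.1 (hs j) with h0 | h0
      · simp [h0]
      · rcases Nat.eq_zero_or_pos (q j) with h1 | h1
        · simp [h0, h1]
        · rw [h0, mul_one, min_eq_right (by omega)]
          push_cast [Nat.cast_sub (by omega : 1 ≤ q j)]
          ring
    · simp [Pi.single_eq_of_ne hj]
  · rw [hM]
    rcases Nat.le_one_iff_eq_zero_or_eq_one.1 (hs i) with h0 | h0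
    · simp [h0]
    · rcases Nat.eq_zero_or_pos (q i) with h1 | h1
      · simp [h1]
      · rw [h0, mul_one, min_eq_right (by omega)]; simp

theorem gram_add_left (z : ℝ) (x x' y : Fin N → ℝ) :
    gram z (x + x') y = gram z x y + gram z x' y := by
  simp only [gram, Pi.add_apply, add_mul, Finset.sum_add_distrib]; ring

theorem gram_comm (z : ℝ) (x y : Fin N → ℝ) : gram z x y = gram z y x := by
  simp only [gram, mul_comm]

theorem gram_add_right (z : ℝ) (x y y' : Fin N → ℝ) :
    gram z x (y + y') = gram z x y + gram z x y' := by
  rw [gram_comm, gram_add_left, gram_comm z y, gram_comm z y']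

theorem gram_sub_left (z : ℝ) (x x' y : Fin N → ℝ) :
    gram z (x - x') y = gram z x y - gram z x' y := by
  simp only [gram, Pi.sub_apply, sub_mul, Finset.sum_sub_distrib]; ring

theorem gram_sub_right (z : ℝ) (x y y' : Fin N → ℝ) :
    gram z x (y - y') = gram z x y - gram z x y' := by
  rw [gram_comm, gram_sub_left, gram_comm z y, gram_comm z y']

theorem gram_single_right (z : ℝ) (x : Fin N → ℝ) (i : Fin N) (d : ℝ) :
    gram z x (Pi.single i d) = (z * x i + (1 - z) * ∑ j, x j) * d := by
  simp only [gram, Pi.single_apply, mul_ite, mul_zero, Finset.sum_ite_eq', Finset.mem_univ, if_true]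
  ring

theorem gram_nonneg {z : ℝ} (h0 : 0 ≤ z) (h1 : z ≤ 1) {x y : Fin N → ℝ} (hx : 0 ≤ x) (hy : 0 ≤ y) :
    0 ≤ gram z x y := by
  have a := Finset.sum_nonneg fun i (_ : i ∈ Finset.univ) => mul_nonneg (hx i) (hy i)
  have b := Finset.sum_nonneg fun i (_ : i ∈ Finset.univ) => hx i
  have c := Finset.sum_nonneg fun i (_ : i ∈ Finset.univ) => hy i
  exact add_nonneg (mul_nonneg h0 a) (mul_nonneg (by linarith) (mul_nonneg b c))

theorem sum_mul_self_le {x : Fin N → ℝ} (hx : 0 ≤ x) : ∑ i, x i * x i ≤ (∑ i, x i) * ∑ i, x i := by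
  rw [Finset.sum_mul]
  exact Finset.sum_le_sum fun i hi => mul_le_mul_of_nonneg_left
    (Finset.single_le_sum (fun j _ => hx j) hi) (hx i)

theorem gram_self_le {z : ℝ} (h0 : 0 ≤ z) {x : Fin N → ℝ} (hx : 0 ≤ x) :
    gram z x x ≤ (∑ i, x i) ^ 2 := by
  have := mul_le_mul_of_nonneg_left (sum_mul_self_le hx) h0
  unfold gram
  nlinarith

theorem sum_mul_self_le_gram {z : ℝ} (h1 : z ≤ 1) {x : Fin N → ℝ} (hx : 0 ≤ x) :
    ∑ i, x i * x i ≤ gram z x x := by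
  have := mul_le_mul_of_nonneg_left (sum_mul_self_le hx) (by linarith : 0 ≤ 1 - z)
  unfold gram
  linarith

theorem castVec_nonneg (q : Fin N → ℕ) : 0 ≤ castVec q := fun i => Nat.cast_nonneg (q i)

theorem castVec_add (q a : Fin N → ℕ) : castVec (q + a) = castVec q + castVec a := by
  ext i; simp [castVec]

theorem sum_le_gram_self {z : ℝ} (h1 : z ≤ 1) (q : Fin N → ℕ) :
    ∑ i, (q i : ℝ) ≤ gram z (castVec q) (castVec q) := by
  refine le_trans (Finset.sum_le_sum fun i _ => ?_) (sum_mul_self_le_gram h1 (castVec_nonneg q))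
  simp only [castVec]
  exact_mod_cast Nat.le_mul_self (q i)

theorem maxConn_le_sum {q s : Fin N → ℕ} (hs : ∀ i, s i ≤ 1) : maxConn q s ≤ ∑ i, q i :=
  Finset.sup_le fun j _ => le_trans (by nlinarith [hs j])
    (Finset.single_le_sum (f := q) (fun _ _ => Nat.zero_le _) (Finset.mem_univ j))

end Quadratic

theorem natCast_eq_sum_range_ite {n B : ℕ} (h : n ≤ B) :
    (n : ℝ) = ∑ l ∈ Finset.range B, if l < n then 1 else 0 := by
  rw [Finset.sum_boole]
  congr 1
  have : (Finset.range B).filter (· < n) = Finset.range n := by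
    ext l; simp only [Finset.mem_filter, Finset.mem_range]; omega
  rw [this, Finset.card_range]

/-- Layer decomposition of the weight served by LCQ. -/
theorem sum_layers_le_servedWeight {N : ℕ} {z : ℝ} (h1 : z ≤ 1) {q s : Fin N → ℕ}
    (hs : ∀ i, s i ≤ 1) :
    ∑ l ∈ Finset.range (∑ i, q i), (z + (1 - z) * (Finset.univ.filter (l < q ·)).card) *
      (if ∃ j ∈ Finset.univ.filter (l < q ·), s j = 1 then 1 else 0) ≤ servedWeight z q s := by
  -- The largest connected backlog exceeds l exactly when some link with backlog above l is ON, so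
  -- every layer indicator is a threshold of `maxConn`.
  have key : ∀ l, (∃ j ∈ Finset.univ.filter (l < q ·), s j = 1) ↔ l < maxConn q s := by
    intro l
    unfold maxConn
    rw [Finset.lt_sup_iff]
    constructor
    · rintro ⟨j, hj, hj1⟩
      exact ⟨j, Finset.mem_univ j, by simpa [hj1] using hj⟩
    · rintro ⟨j, -, hj⟩
      rcases Nat.le_one_iff_eq_zero_or_eq_one.1 (hs j) with h0 | h0
      · simp [h0] at hj
      · exact ⟨j, by simpa [h0] using hj, h0⟩
  have hB := maxConn_le_sum (q := q) hs
  have hsum : ∑ i, (q i : ℝ) =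
      ∑ l ∈ Finset.range (∑ i, q i), ((Finset.univ.filter (l < q ·)).card : ℝ) := by
    have : ∀ i, (q i : ℝ) = ∑ l ∈ Finset.range (∑ i, q i), if l < q i then 1 else 0 := fun i =>
      natCast_eq_sum_range_ite
        (Finset.single_le_sum (f := q) (fun _ _ => Nat.zero_le _) (Finset.mem_univ i))
    rw [Finset.sum_congr rfl fun i _ => this i, Finset.sum_comm]
    exact Finset.sum_congr rfl fun l _ => Finset.sum_boole _ _
  unfold servedWeight
  rw [natCast_eq_sum_range_ite hB, hsum, Finset.mul_sum, Finset.sum_mul, Finset.mul_sum,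
    ← Finset.sum_add_distrib]
  refine Finset.sum_le_sum fun l _ => ?_
  simp only [key]
  by_cases hl : l < maxConn q s
  · have : min (maxConn q s) 1 = 1 := min_eq_right (by omega)
    simp only [hl, if_true, this]
    push_cast
    exact le_of_eq (by ring)
  -- Layers above `maxConn` vanish on the left; on the right they keep a nonnegative share of the
  -- term (1 - z) ∑ q_i.
  · simp only [hl, if_false, mul_zero, zero_add]
    exact mul_nonneg (by linarith) (by positivity)

namespace OnOffSystem

variable {Ω : Type*} [MeasurableSpace Ω] {P : Measure Ω} {N : ℕ} {p lam : Fin N → ℝ}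

/-! ### Channel states -/

theorem integrable_chan [IsProbabilityMeasure P] (X : OnOffSystem P p lam)
    (t : ℕ) (f : (Fin N → ℕ) → ℝ) : Integrable (fun ω => f (X.chan t ω)) P := by
  refine Integrable.of_bound (C := ∑ s ∈ Fintype.piFinset fun _ : Fin N => Finset.range 2, ‖f s‖)
    (((measurable_of_countable f).comp (X.measurable_chan t)).aestronglyMeasurable)
    (ae_of_all _ fun ω => ?_)
  refine Finset.single_le_sum (f := fun s => ‖f s‖) (fun _ _ => norm_nonneg _) ?_
  simp only [Fintype.mem_piFinset, Finset.mem_range]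
  intro i
  have := X.chan_le_one t ω i
  omega

theorem prob_nonneg (X : OnOffSystem P p lam) (i : Fin N) : 0 ≤ p i := by
  rw [← X.prob_chan 0 i]; exact measureReal_nonneg

theorem prob_le_one [IsProbabilityMeasure P] (X : OnOffSystem P p lam) (i : Fin N) : p i ≤ 1 := by
  rw [← X.prob_chan 0 i]; exact measureReal_le_one

theorem pMin_nonneg (X : OnOffSystem P p lam) : 0 ≤ pMin p := Real.iInf_nonneg X.prob_nonneg

theorem pMin_le (i : Fin N) : pMin p ≤ p i := ciInf_le (Set.finite_range p).bddBelow i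

theorem pMin_le_one [IsProbabilityMeasure P] (X : OnOffSystem P p lam) : pMin p ≤ 1 := by
  rcases isEmpty_or_nonempty (Fin N) with h | ⟨⟨i⟩⟩
  · simp [pMin]
  · exact (pMin_le i).trans (X.prob_le_one i)

/-- By independence over links, all links of `U` are OFF with probability ∏ (1 - p_j) ≤ (1 -
p_min)^|U|. -/
theorem le_prob_connected [IsProbabilityMeasure P] (X : OnOffSystem P p lam) (t : ℕ)
    (U : Finset (Fin N)) : 1 - (1 - pMin p) ^ U.card ≤
      ∫ ω, (if ∃ j ∈ U, X.chan t ω j = 1 then (1 : ℝ) else 0) ∂P := by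
  have hm : ∀ j, MeasurableSet {ω | X.chan t ω j = 1} := fun j =>
    ((measurable_pi_apply j).comp (X.measurable_chan t)) (measurableSet_singleton 1)
  set E : Set Ω := ⋂ j ∈ U, (fun ω => X.chan t ω j) ⁻¹' {1}ᶜ with hE
  have hEm : MeasurableSet E := Finset.measurableSet_biInter _ fun j _ => (hm j).compl
  have hint : ∀ ω, (if ∃ j ∈ U, X.chan t ω j = 1 then (1 : ℝ) else 0) = Eᶜ.indicator 1 ω := by
    intro ω
    have : (∃ j ∈ U, X.chan t ω j = 1) ↔ ω ∈ Eᶜ := by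
      simp [hE]
    by_cases h : ω ∈ Eᶜ
    · rw [if_pos (this.2 h), Set.indicator_of_mem h]; rfl
    · rw [if_neg (fun h' => h (this.1 h')), Set.indicator_of_notMem h]
  rw [integral_congr_ae (ae_of_all _ hint), integral_indicator_one hEm.compl,
    probReal_compl_eq_one_sub hEm]
  have hprod : P.real E = ∏ j ∈ U, (1 - p j) := by
    rw [measureReal_def, hE, (X.iIndepFun_chan t).measure_inter_preimage_eq_mul U
      (sets := fun _ => {1}ᶜ) (fun j _ => (measurableSet_singleton 1).compl), ENNReal.toReal_prod]
    refine Finset.prod_congr rfl fun j _ => ?_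
    rw [← X.prob_chan t j, ← probReal_compl_eq_one_sub (hm j)]
    rfl
  rw [hprod]
  have : ∏ j ∈ U, (1 - p j) ≤ ∏ _j ∈ U, (1 - pMin p) :=
    Finset.prod_le_prod (fun j _ => by linarith [X.prob_le_one j])
      fun j _ => by linarith [pMin_le (p := p) j]
  rw [Finset.prod_const] at this
  linarith

theorem le_integral_servedWeight [IsProbabilityMeasure P] (X : OnOffSystem P p lam) {K : ℕ}
    (hK : 1 ≤ K) (hN : K ≤ N) (t : ℕ) (q : Fin N → ℕ) :
    (∑ i, (q i : ℝ)) * ((1 - (1 - pMin p) ^ K) / K) ≤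
      ∫ ω, servedWeight (zConst N K) q (X.chan t ω) ∂P := by
  have hz0 := zConst_nonneg hK hN
  have hz1 := zConst_le_one hK hN
  have hsum : ∑ i, (q i : ℝ) =
      ∑ l ∈ Finset.range (∑ i, q i), ((Finset.univ.filter (l < q ·)).card : ℝ) := by
    have : ∀ i, (q i : ℝ) = ∑ l ∈ Finset.range (∑ i, q i), if l < q i then 1 else 0 := fun i =>
      natCast_eq_sum_range_ite
        (Finset.single_le_sum (f := q) (fun _ _ => Nat.zero_le _) (Finset.mem_univ i))
    rw [Finset.sum_congr rfl fun i _ => this i, Finset.sum_comm]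
    exact Finset.sum_congr rfl fun l _ => Finset.sum_boole _ _
  calc _ = ∑ l ∈ Finset.range (∑ i, q i), ((Finset.univ.filter (l < q ·)).card : ℝ) *
        ((1 - (1 - pMin p) ^ K) / K) := by rw [hsum, Finset.sum_mul]
    _ ≤ ∑ l ∈ Finset.range (∑ i, q i),
        (zConst N K + (1 - zConst N K) * (Finset.univ.filter (l < q ·)).card) *
        ∫ ω, (if ∃ j ∈ Finset.univ.filter (l < q ·), X.chan t ω j = 1 then (1 : ℝ) else 0) ∂P := by
        refine Finset.sum_le_sum fun l _ => ?_
        refine (layer_bound hK hN X.pMin_nonneg X.pMin_le_one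
          ((Finset.card_le_univ _).trans (by simp))).trans ?_
        exact mul_le_mul_of_nonneg_left (X.le_prob_connected t _)
          (add_nonneg hz0 (mul_nonneg (by linarith) (Nat.cast_nonneg _)))
    _ = ∫ ω, ∑ l ∈ Finset.range (∑ i, q i),
        (zConst N K + (1 - zConst N K) * (Finset.univ.filter (l < q ·)).card) *
        (if ∃ j ∈ Finset.univ.filter (l < q ·), X.chan t ω j = 1 then (1 : ℝ) else 0) ∂P := by
        rw [integral_finsetSum]
        · exact Finset.sum_congr rfl fun l _ => (integral_const_mul _ _).symm
        · exact fun l _ => X.integrable_chan t fun s =>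
            (zConst N K + (1 - zConst N K) * (Finset.univ.filter (l < q ·)).card) *
            (if ∃ j ∈ Finset.univ.filter (l < q ·), s j = 1 then (1 : ℝ) else 0)
    _ ≤ _ := by
        refine integral_mono ?_ (X.integrable_chan t fun s => servedWeight (zConst N K) q s)
          fun ω => sum_layers_le_servedWeight hz1 (X.chan_le_one t ω)
        exact X.integrable_chan t fun s => ∑ l ∈ Finset.range (∑ i, q i),
          (zConst N K + (1 - zConst N K) * (Finset.univ.filter (l < q ·)).card) *
          (if ∃ j ∈ Finset.univ.filter (l < q ·), s j = 1 then (1 : ℝ) else 0)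

theorem le_integral_min_maxConn [IsProbabilityMeasure P] (X : OnOffSystem P p lam)
    (t : ℕ) {q : Fin N → ℕ} (hq : q ≠ 0) :
    pMin p ≤ ∫ ω, ((min (maxConn q (X.chan t ω)) 1 : ℕ) : ℝ) ∂P := by
  obtain ⟨i, hi⟩ := Function.ne_iff.1 hq
  have h := X.le_prob_connected t {i}
  simp only [Finset.card_singleton, pow_one, sub_sub_cancel] at h
  refine h.trans (integral_mono (X.integrable_chan t fun s => if ∃ j ∈ ({i} : Finset _), s j = 1
    then (1 : ℝ) else 0) (X.integrable_chan t fun s => ((min (maxConn q s) 1 : ℕ) : ℝ)) fun ω => ?_)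
  simp only [Finset.mem_singleton, exists_eq_left]
  split_ifs with hc
  · have : q i * X.chan t ω i ≤ maxConn q (X.chan t ω) :=
      Finset.le_sup (f := fun j => q j * X.chan t ω j) (Finset.mem_univ i)
    have hi' : q i ≠ 0 := hi
    rw [hc, mul_one] at this
    rw [min_eq_right (by omega)]
    simp
  · positivity

/-! ### Arrivals -/

/-- Only the marginals are assumed to be identically distributed over slots; independence over links
turns this into equality of the joint laws. -/
theorem map_arr [IsProbabilityMeasure P] (X : OnOffSystem P p lam) (t : ℕ) :
    P.map (X.arr t) = P.map (X.arr 0) := by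
  have h : ∀ t, P.map (X.arr t) = Measure.pi fun i => P.map fun ω => X.arr 0 ω i := by
    intro t
    have := (iIndepFun_iff_map_fun_eq_pi_map fun i =>
      ((measurable_pi_apply i).comp (X.measurable_arr t)).aemeasurable).1 (X.iIndepFun_arr t)
    refine this.trans ?_
    congr 1
    ext1 i
    exact (X.identDistrib_arr t i).map_eq
  rw [h t, h 0]

theorem integral_arr [IsProbabilityMeasure P] (X : OnOffSystem P p lam) (t : ℕ)
    (f : (Fin N → ℕ) → ℝ) : ∫ ω, f (X.arr t ω) ∂P = ∫ ω, f (X.arr 0 ω) ∂P := by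
  have hf : Measurable f := measurable_of_countable f
  rw [← integral_map (X.measurable_arr t).aemeasurable hf.aestronglyMeasurable, X.map_arr t,
    integral_map (X.measurable_arr 0).aemeasurable hf.aestronglyMeasurable]

theorem memLp_arr' (X : OnOffSystem P p lam) (t : ℕ) (i : Fin N) :
    MemLp (fun ω => (X.arr t ω i : ℝ)) 2 P := by
  have h := (X.identDistrib_arr t i).comp (measurable_of_countable fun n : ℕ => (n : ℝ))
  exact h.symm.memLp_iff.1 (X.memLp_arr i)

theorem integrable_sum_arr_sq (X : OnOffSystem P p lam) (t : ℕ) :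
    Integrable (fun ω => (∑ i, (X.arr t ω i : ℝ)) ^ 2) P :=
  (memLp_finsetSum (f := fun i ω => (X.arr t ω i : ℝ)) Finset.univ
    fun i _ => X.memLp_arr' t i).integrable_sq

theorem integrable_arr_apply [IsProbabilityMeasure P] (X : OnOffSystem P p lam) (t : ℕ)
    (i : Fin N) : Integrable (fun ω => (X.arr t ω i : ℝ)) P :=
  (X.memLp_arr' t i).integrable (by norm_num)

theorem integrable_arr [IsProbabilityMeasure P] (X : OnOffSystem P p lam) (t : ℕ)
    {f : (Fin N → ℕ) → ℝ} {k : ℝ} (hf : ∀ a, |f a| ≤ k * (1 + (∑ i, (a i : ℝ)) ^ 2)) :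
    Integrable (fun ω => f (X.arr t ω)) P :=
  Integrable.mono' (((integrable_const (1 : ℝ)).add (X.integrable_sum_arr_sq t)).const_mul k)
    (((measurable_of_countable f).comp (X.measurable_arr t)).aestronglyMeasurable)
    (ae_of_all _ fun _ => hf _)

theorem integral_arr_apply [IsProbabilityMeasure P] (X : OnOffSystem P p lam) (t : ℕ)
    (i : Fin N) : ∫ ω, (X.arr t ω i : ℝ) ∂P = lam i := by
  rw [X.integral_arr t fun a => (a i : ℝ), X.mean_arr]

theorem lam_nonneg (X : OnOffSystem P p lam) (i : Fin N) : 0 ≤ lam i := by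
  rw [← X.mean_arr i]; exact integral_nonneg fun _ => Nat.cast_nonneg _

theorem integral_sum_mul_arr [IsProbabilityMeasure P] (X : OnOffSystem P p lam) (t : ℕ)
    (w : Fin N → ℝ) : ∫ ω, ∑ i, w i * (X.arr t ω i : ℝ) ∂P = ∑ i, w i * lam i := by
  rw [integral_finsetSum _ fun i _ => (X.integrable_arr_apply t i).const_mul _]
  exact Finset.sum_congr rfl fun i _ => by rw [integral_const_mul, X.integral_arr_apply]

theorem integrable_sum_mul_arr [IsProbabilityMeasure P] (X : OnOffSystem P p lam) (t : ℕ)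
    (w : Fin N → ℝ) : Integrable (fun ω => ∑ i, w i * (X.arr t ω i : ℝ)) P :=
  integrable_finsetSum _ fun i _ => (X.integrable_arr_apply t i).const_mul _

theorem integral_sum_arr [IsProbabilityMeasure P] (X : OnOffSystem P p lam) (t : ℕ) :
    ∫ ω, ∑ i, (X.arr t ω i : ℝ) ∂P = ∑ i, lam i := by
  simpa using X.integral_sum_mul_arr t fun _ => 1

/-- Second moment of the total arrivals of a slot. -/
theorem integral_sum_arr_sq [IsProbabilityMeasure P] (X : OnOffSystem P p lam) (t : ℕ) :
    ∫ ω, (∑ i, (X.arr t ω i : ℝ)) ^ 2 ∂P =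
      (∑ i, ∫ ω, (X.arr t ω i : ℝ) ^ 2 ∂P) - ∑ i, lam i ^ 2 + (∑ i, lam i) ^ 2 := by
  have hv := IndepFun.variance_sum (μ := P) (X := fun i ω => (X.arr t ω i : ℝ))
    (s := Finset.univ) (fun i _ => X.memLp_arr' t i) (fun i _ j _ hij =>
      ((X.iIndepFun_arr t).indepFun hij).comp (φ := fun n : ℕ => (n : ℝ))
        (ψ := fun n : ℕ => (n : ℝ)) (measurable_of_countable _) (measurable_of_countable _))
  have hS : (∑ i, fun ω => (X.arr t ω i : ℝ)) = fun ω => ∑ i, (X.arr t ω i : ℝ) := by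
    ext ω; simp
  rw [hS, variance_eq_sub (memLp_finsetSum (f := fun i ω => (X.arr t ω i : ℝ)) Finset.univ
    fun i _ => X.memLp_arr' t i), X.integral_sum_arr t] at hv
  have : ∀ i, variance (fun ω => (X.arr t ω i : ℝ)) P =
      ∫ ω, (X.arr t ω i : ℝ) ^ 2 ∂P - lam i ^ 2 := fun i => by
    rw [variance_eq_sub (X.memLp_arr' t i), X.integral_arr_apply]; rfl
  rw [Finset.sum_congr rfl fun i _ => this i, Finset.sum_sub_distrib] at hv
  simp only [Pi.pow_apply] at hv
  linarith

end OnOffSystem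

/-! ### Expected change over one slot -/

/-- Fubini on the product law: the independent variable is averaged first, with the other one
frozen. It replaces conditional expectations. Countability of the value spaces makes all functions
measurable. -/
theorem lintegral_le_of_indepFun {Ω α β : Type*} [MeasurableSpace Ω] {P : Measure Ω}
    [IsProbabilityMeasure P] [MeasurableSpace α] [MeasurableSpace β] [Countable α] [Countable β]
    [MeasurableSingletonClass α] [MeasurableSingletonClass β] {Y : Ω → α} {A : Ω → β}
    (hY : Measurable Y) (hA : Measurable A) (h : IndepFun Y A P) (f : α → β → ℝ≥0∞) (g : α → ℝ≥0∞)
    (hfg : ∀ ω', ∫⁻ ω, f (Y ω') (A ω) ∂P ≤ g (Y ω')) :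
    ∫⁻ ω, f (Y ω) (A ω) ∂P ≤ ∫⁻ ω, g (Y ω) ∂P := by
  have hm : Measurable (Function.uncurry f) := measurable_of_countable _
  have : IsProbabilityMeasure (P.map A) := Measure.isProbabilityMeasure_map hA.aemeasurable
  have : IsProbabilityMeasure (P.map Y) := Measure.isProbabilityMeasure_map hY.aemeasurable
  calc ∫⁻ ω, f (Y ω) (A ω) ∂P = ∫⁻ y, Function.uncurry f y ∂(P.map fun ω => (Y ω, A ω)) := by
        rw [lintegral_map hm (hY.prodMk hA)]; rfl
    _ = ∫⁻ y, ∫⁻ a, f y a ∂(P.map A) ∂(P.map Y) := by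
        rw [(indepFun_iff_map_prod_eq_prod_map_map hY.aemeasurable hA.aemeasurable).1 h,
          lintegral_prod _ hm.aemeasurable]
        rfl
    _ = ∫⁻ ω', ∫⁻ ω, f (Y ω') (A ω) ∂P ∂P := by
        rw [lintegral_map (measurable_of_countable _) hY]
        exact lintegral_congr fun ω' => lintegral_map (measurable_of_countable _) hA
    _ ≤ _ := lintegral_mono hfg

theorem add_sum_range_le_of_step {a b c : ℕ → ℝ≥0∞} (h : ∀ t, a (t + 1) + b t ≤ a t + c t) (t : ℕ) :
    a t + ∑ τ ∈ Finset.range t, b τ ≤ a 0 + ∑ τ ∈ Finset.range t, c τ := by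
  induction t with
  | zero => simp
  | succ t ih =>
    rw [Finset.sum_range_succ, Finset.sum_range_succ]
    calc _ = (a (t + 1) + b t) + ∑ τ ∈ Finset.range t, b τ := by ring
      _ ≤ (a t + c t) + ∑ τ ∈ Finset.range t, b τ := add_le_add_left (h t) _
      _ = (a t + ∑ τ ∈ Finset.range t, b τ) + c t := by ring
      _ ≤ (a 0 + ∑ τ ∈ Finset.range t, c τ) + c t := by gcongr
      _ = _ := by ring

namespace OnOffSystem

variable {Ω : Type*} [MeasurableSpace Ω] {P : Measure Ω} {N : ℕ} {p lam : Fin N → ℝ}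

/-- The history before slot `t`. -/
def hist (X : OnOffSystem P p lam) (t : ℕ) (ω : Ω) :
    (Fin N → ℕ) × (Fin t → (Fin N → ℕ) × (Fin N → ℕ) × (Fin N → ℕ)) :=
  (X.init ω, fun s : Fin t => (X.arr s ω, X.chan s ω, X.mu s ω))

theorem measurable_hist (X : OnOffSystem P p lam) (t : ℕ) : Measurable (X.hist t) :=
  X.measurable_init.prodMk (measurable_pi_lambda _ fun s =>
    (X.measurable_arr s).prodMk ((X.measurable_chan s).prodMk (X.measurable_mu s)))

theorem hist_eq_iff (X : OnOffSystem P p lam) {t : ℕ} {ω ω' : Ω} :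
    X.hist t ω = X.hist t ω' ↔ X.init ω = X.init ω' ∧ ∀ s < t, X.arr s ω = X.arr s ω' ∧
      X.chan s ω = X.chan s ω' ∧ X.mu s ω = X.mu s ω' := by
  simp only [hist, Prod.mk.injEq, funext_iff (β := fun _ : Fin t => _), Fin.forall_iff]

theorem queue_factorsThrough (X : OnOffSystem P p lam) {t t' : ℕ} (ht : t ≤ t') :
    Function.FactorsThrough (X.queue t) (X.hist t') := by
  intro ω ω' h
  rw [hist_eq_iff] at h
  induction t with
  | zero => exact funext fun i => congr_fun h.1 i
  | succ t ih =>
    ext i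
    simp only [queue, ih (by omega), (h.2 t (by omega)).1, (h.2 t (by omega)).2.2]

theorem departed_factorsThrough (X : OnOffSystem P p lam) (t : ℕ) :
    Function.FactorsThrough (X.departed t) (X.hist t) := by
  intro ω ω' h
  ext i
  refine Finset.sum_congr rfl fun τ hτ => ?_
  rw [Finset.mem_range] at hτ
  rw [X.queue_factorsThrough hτ.le h, ((X.hist_eq_iff.1 h).2 τ hτ).2.2]

theorem entered_factorsThrough (X : OnOffSystem P p lam) {t t' : ℕ} (ht : t ≤ t') :
    Function.FactorsThrough (X.entered t) (X.hist t') := by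
  intro ω ω' h
  rw [hist_eq_iff] at h
  ext i
  simp only [entered, h.1]
  congr 1
  refine Finset.sum_congr rfl fun τ hτ => ?_
  rw [Finset.mem_range] at hτ
  rw [(h.2 τ (by omega)).1]

theorem measurable_of_factorsThrough (X : OnOffSystem P p lam) {t : ℕ} {β : Type*}
    [MeasurableSpace β] [Nonempty β] {g : Ω → β} (h : Function.FactorsThrough g (X.hist t)) :
    Measurable g := by
  have : g = (Function.extend (X.hist t) g fun _ => Classical.arbitrary β) ∘ X.hist t := by
    ext ω; exact (h.extend_apply _ ω).symm
  rw [this]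
  exact (measurable_of_countable _).comp (X.measurable_hist t)

theorem measurable_queue (X : OnOffSystem P p lam) (t : ℕ) : Measurable (X.queue t) :=
  X.measurable_of_factorsThrough (X.queue_factorsThrough le_rfl)

theorem queue_succ (X : OnOffSystem P p lam) (t : ℕ) (ω : Ω) :
    X.queue (t + 1) ω = X.queue t ω - X.mu t ω + X.arr t ω := rfl

theorem queue_add_departed (X : OnOffSystem P p lam) (t : ℕ) (ω : Ω) (i : Fin N) :
    X.queue t ω i + X.departed t ω i = X.entered t ω i := by
  induction t with
  | zero => simp [queue, departed, entered]
  | succ t ih =>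
    simp only [queue, departed, entered, Finset.sum_range_succ] at ih ⊢
    omega

/-- One slot of LCQ: an upper bound on the expected change of a nonnegative function of the
backlogs, weighted by a function of the history. -/
theorem lintegral_step_le [IsProbabilityMeasure P] (X : OnOffSystem P p lam) (hX : X.IsLCQ)
    (hN : 0 < N) (t : ℕ) (F : (Fin N → ℕ) → ℝ) (hF : ∀ x, 0 ≤ F x)
    (hint : ∀ x, Integrable (fun ω => F (x + X.arr t ω)) P)
    (g : (Fin N → ℕ) → (Fin N → ℕ) → ℝ) (u v : (Fin N → ℕ) → ℝ) (hv : ∀ q, 0 ≤ v q)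
    (hg : ∀ q s m, (∀ i, s i ≤ 1) → IsLongestConnected q s m →
      ∫ ω, F (q - m + X.arr t ω) ∂P ≤ g q s)
    (hguv : ∀ q, ∫ ω, g q (X.chan t ω) ∂P ≤ u q - v q)
    (w : Ω → ℝ≥0∞) (hw : Function.FactorsThrough w (X.hist t)) :
    ∫⁻ ω, w ω * ENNReal.ofReal (F (X.queue (t + 1) ω)) ∂P +
      ∫⁻ ω, w ω * ENNReal.ofReal (v (X.queue t ω)) ∂P ≤
      ∫⁻ ω, w ω * ENNReal.ofReal (u (X.queue t ω)) ∂P := by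
  -- Positivity of `g` is inherited from the integral that it dominates; a decision to compare with
  -- exists because there is at least one link.
  have hg0 : ∀ q s, (∀ i, s i ≤ 1) → 0 ≤ g q s := fun q s hs => by
    obtain ⟨m, hm⟩ := exists_isLongestConnected hN q s
    exact (integral_nonneg fun ω => hF _).trans (hg q s m hs hm)
  set W := Function.extend (X.hist t) w fun _ => 0
  set Q := Function.extend (X.hist t) (X.queue t) fun _ => 0
  have hW : ∀ ω, W (X.hist t ω) = w ω := fun ω => hw.extend_apply _ ω
  have hQ : ∀ ω, Q (X.hist t ω) = X.queue t ω := fun ω =>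
    (X.queue_factorsThrough le_rfl).extend_apply _ ω
  have hqm := X.measurable_queue t
  have hwm := X.measurable_of_factorsThrough hw
  -- Average over the arrivals, with history, channel states and decision frozen.
  have h1 : ∫⁻ ω, w ω * ENNReal.ofReal (F (X.queue (t + 1) ω)) ∂P ≤
      ∫⁻ ω, w ω * ENNReal.ofReal (g (X.queue t ω) (X.chan t ω)) ∂P := by
    have := lintegral_le_of_indepFun (P := P)
      (Y := fun ω => (X.hist t ω, X.chan t ω, X.mu t ω)) (A := X.arr t)
      ((X.measurable_hist t).prodMk ((X.measurable_chan t).prodMk (X.measurable_mu t)))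
      (X.measurable_arr t) (X.indep_arr t)
      (fun y a => W y.1 * ENNReal.ofReal (F (Q y.1 - y.2.2 + a)))
      (fun y => W y.1 * ENNReal.ofReal (g (Q y.1) y.2.1)) (fun ω' => by
        simp only [hW, hQ]
        have hm : Measurable fun ω =>
            ENNReal.ofReal (F (X.queue t ω' - X.mu t ω' + X.arr t ω)) :=
          (measurable_of_countable fun a =>
            ENNReal.ofReal (F (X.queue t ω' - X.mu t ω' + a))).comp (X.measurable_arr t)
        rw [lintegral_const_mul _ hm]
        refine mul_le_mul_right ?_ _
        rw [← ofReal_integral_eq_lintegral_ofReal (hint _) (ae_of_all _ fun ω => hF _)]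
        exact ENNReal.ofReal_le_ofReal (hg _ _ _ (X.chan_le_one t ω') (hX t ω')))
    simpa only [hW, hQ, queue_succ] using this
  -- Average over the channel states, with only the history frozen.
  have h2 : ∫⁻ ω, w ω * ENNReal.ofReal (g (X.queue t ω) (X.chan t ω)) ∂P ≤
      ∫⁻ ω, w ω * ENNReal.ofReal (u (X.queue t ω) - v (X.queue t ω)) ∂P := by
    have := lintegral_le_of_indepFun (P := P) (Y := X.hist t) (A := X.chan t)
      (X.measurable_hist t) (X.measurable_chan t) (X.indep_chan t)
      (fun y s => W y * ENNReal.ofReal (g (Q y) s))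
      (fun y => W y * ENNReal.ofReal (u (Q y) - v (Q y))) (fun ω' => by
        simp only [hW, hQ]
        have hm : Measurable fun ω => ENNReal.ofReal (g (X.queue t ω') (X.chan t ω)) :=
          (measurable_of_countable fun s => ENNReal.ofReal (g (X.queue t ω') s)).comp
            (X.measurable_chan t)
        rw [lintegral_const_mul _ hm]
        refine mul_le_mul_right ?_ _
        rw [← ofReal_integral_eq_lintegral_ofReal (X.integrable_chan t _)
          (ae_of_all _ fun ω => hg0 _ _ (X.chan_le_one t ω))]
        exact ENNReal.ofReal_le_ofReal (hguv _))
    simpa only [hW, hQ] using this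
  -- Needed because `ENNReal.ofReal` truncates: only then do the images of u - v and v add up to
  -- that of u.
  have huv : ∀ q, v q ≤ u q := fun q => by
    have := (integral_nonneg fun ω => hg0 q _ (X.chan_le_one t ω)).trans (hguv q)
    linarith
  calc _ ≤ ∫⁻ ω, w ω * ENNReal.ofReal (u (X.queue t ω) - v (X.queue t ω)) ∂P +
      ∫⁻ ω, w ω * ENNReal.ofReal (v (X.queue t ω)) ∂P := add_le_add_left (h1.trans h2) _
    _ = ∫⁻ ω, w ω * ENNReal.ofReal (u (X.queue t ω)) ∂P := by
      have hm : Measurable fun ω => w ω * ENNReal.ofReal (v (X.queue t ω)) :=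
        hwm.mul ((measurable_of_countable fun q => ENNReal.ofReal (v q)).comp hqm)
      rw [← lintegral_add_right _ hm]
      refine lintegral_congr fun ω => ?_
      rw [← mul_add, ← ENNReal.ofReal_add (by linarith [huv (X.queue t ω)]) (hv _),
        sub_add_cancel]

end OnOffSystem

/-! ### Quadratic drift and the average backlog -/

theorem gram_eq_sum {N : ℕ} (z : ℝ) (x y : Fin N → ℝ) :
    gram z x y = ∑ i, (z * x i + (1 - z) * ∑ j, x j) * y i := by
  simp only [gram, add_mul, Finset.sum_add_distrib, mul_assoc, ← Finset.mul_sum]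

theorem tendsto_const_div_natCast {a : ℝ≥0∞} (ha : a ≠ ∞) :
    Tendsto (fun t : ℕ => a / (t : ℝ≥0∞)) atTop (𝓝 0) := by
  have := ENNReal.Tendsto.const_div ENNReal.tendsto_nat_nhds_top (Or.inr ha) (a := a)
  simpa using this

theorem limsup_div_natCast_le {S e : ℕ → ℝ≥0∞} {b : ℝ≥0∞} (h : ∀ t : ℕ, S t ≤ e t + t * b)
    (he : Tendsto (fun t : ℕ => e t / (t : ℝ≥0∞)) atTop (𝓝 0)) :
    limsup (fun t : ℕ => S t / (t : ℝ≥0∞)) atTop ≤ b := by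
  have h1 : Tendsto (fun t : ℕ => e t / (t : ℝ≥0∞) + b) atTop (𝓝 (0 + b)) :=
    he.add tendsto_const_nhds
  rw [zero_add] at h1
  rw [← h1.limsup_eq]
  refine limsup_le_limsup ?_
  filter_upwards [eventually_ge_atTop 1] with t ht
  have h0 : (t : ℝ≥0∞) ≠ 0 := by exact_mod_cast (by omega : t ≠ 0)
  calc S t / t ≤ (e t + t * b) / t := ENNReal.div_le_div_right (h t) _
    _ = e t / t + b := by
      rw [ENNReal.add_div, mul_comm, ENNReal.mul_div_cancel_right h0 (ENNReal.natCast_ne_top t)]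

theorem IsLongestConnected.gram_single_eq {N : ℕ} (z : ℝ) {q s : Fin N → ℕ} {i : Fin N}
    (h : (q i : ℝ) * (min (maxConn q s) 1 : ℕ) = maxConn q s) :
    gram z (castVec q) (Pi.single i ((min (maxConn q s) 1 : ℕ) : ℝ)) = servedWeight z q s := by
  rw [gram_single_right, servedWeight, ← h]
  simp only [castVec]
  ring

theorem sq_min_one (n : ℕ) : ((min n 1 : ℕ) : ℝ) * (min n 1 : ℕ) = (min n 1 : ℕ) := by
  rcases Nat.eq_zero_or_pos n with h | h
  · simp [h]
  · rw [min_eq_right (by omega)]; simp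

theorem sum_sub_single {N : ℕ} (x : Fin N → ℝ) (i : Fin N) (d : ℝ) :
    ∑ j, (x - Pi.single i d : Fin N → ℝ) j = (∑ j, x j) - d := by
  simp [Finset.sum_sub_distrib]

namespace OnOffSystem

/-- The quadratic Lyapunov function with a linear correction. -/
noncomputable def lyap {N : ℕ} (z c : ℝ) (q : Fin N → ℕ) : ℝ :=
  1 / 2 * gram z (castVec q) (castVec q) + c * ∑ i, (q i : ℝ)

/-- Backlogs are integers, so the quadratic form dominates ∑ q_i and can absorb a linear coefficient
as low as -1/2. -/
theorem lyap_nonneg {N : ℕ} {z c : ℝ} (h1 : z ≤ 1) (hc : -(1 / 2) ≤ c) (q : Fin N → ℕ) :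
    0 ≤ lyap z c q := by
  have h := sum_le_gram_self h1 q
  have h2 : 0 ≤ ∑ i, (q i : ℝ) := by positivity
  unfold lyap
  nlinarith

variable {Ω : Type*} [MeasurableSpace Ω] {P : Measure Ω} {N : ℕ} {p lam : Fin N → ℝ}

theorem integrable_gram_arr [IsProbabilityMeasure P] (X : OnOffSystem P p lam) (t : ℕ) {z : ℝ}
    (h0 : 0 ≤ z) (h1 : z ≤ 1) :
    Integrable (fun ω => gram z (castVec (X.arr t ω)) (castVec (X.arr t ω))) P := by
  refine X.integrable_arr t (f := fun a => gram z (castVec a) (castVec a)) (k := 1) fun a => ?_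
  rw [abs_of_nonneg (gram_nonneg h0 h1 (castVec_nonneg _) (castVec_nonneg _))]
  have := gram_self_le h0 (castVec_nonneg a)
  simp only [castVec] at this ⊢
  linarith

theorem lyap_add {N : ℕ} (z c : ℝ) (x a : Fin N → ℕ) : lyap z c (x + a) =
    lyap z c x + gram z (castVec x) (castVec a) + c * ∑ i, (a i : ℝ) +
      1 / 2 * gram z (castVec a) (castVec a) := by
  unfold lyap
  rw [castVec_add, gram_add_left, gram_add_right, gram_add_right,
    gram_comm z (castVec a) (castVec x)]
  simp only [Pi.add_apply, Nat.cast_add, Finset.sum_add_distrib]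
  ring

theorem integrable_lyap_add [IsProbabilityMeasure P] (X : OnOffSystem P p lam) (t : ℕ) {z : ℝ}
    (h0 : 0 ≤ z) (h1 : z ≤ 1) (c : ℝ) (x : Fin N → ℕ) :
    Integrable (fun ω => lyap z c (x + X.arr t ω)) P := by
  simp only [lyap_add, gram_eq_sum z (castVec x)]
  refine ((Integrable.add (integrable_const _) (X.integrable_sum_mul_arr t _)).add ?_).add
    ((X.integrable_gram_arr t h0 h1).const_mul _)
  exact (integrable_finsetSum _ fun i _ => X.integrable_arr_apply t i).const_mul c

theorem integral_lyap_add [IsProbabilityMeasure P] (X : OnOffSystem P p lam) (t : ℕ) {z : ℝ}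
    (h0 : 0 ≤ z) (h1 : z ≤ 1) (c : ℝ) (x : Fin N → ℕ) :
    ∫ ω, lyap z c (x + X.arr t ω) ∂P = lyap z c x + gram z (castVec x) lam + c * (∑ i, lam i) +
      1 / 2 * ∫ ω, gram z (castVec (X.arr 0 ω)) (castVec (X.arr 0 ω)) ∂P := by
  have i1 : Integrable (fun ω => gram z (castVec x) (castVec (X.arr t ω))) P := by
    simp only [gram_eq_sum z (castVec x)]
    exact X.integrable_sum_mul_arr t _
  have i2 : Integrable (fun ω => c * ∑ i, (X.arr t ω i : ℝ)) P :=
    (integrable_finsetSum _ fun i _ => X.integrable_arr_apply t i).const_mul c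
  have i3 := (X.integrable_gram_arr t h0 h1).const_mul (1 / 2)
  have i4 : Integrable (fun _ : Ω => lyap z c x) P := integrable_const _
  have e1 : ∫ ω, gram z (castVec x) (castVec (X.arr t ω)) ∂P = gram z (castVec x) lam := by
    simp only [gram_eq_sum z (castVec x)]
    exact X.integral_sum_mul_arr t _
  have i5 : Integrable (fun ω => lyap z c x + gram z (castVec x) (castVec (X.arr t ω))) P :=
    i4.add i1
  have i6 : Integrable (fun ω => lyap z c x + gram z (castVec x) (castVec (X.arr t ω)) +
    c * ∑ i, (X.arr t ω i : ℝ)) P := i5.add i2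
  simp only [lyap_add]
  rw [integral_add i6 i3, integral_add i5 i2, integral_add i4 i1,
    integral_const_mul, integral_const_mul, X.integral_sum_arr t, e1,
    X.integral_arr t fun a => gram z (castVec a) (castVec a)]
  simp

/-- Let d ∈ {0, 1} be the number of packets transmitted. The quadratic part yields d/2 from the
squared service and at most -κ d from its product with the arrivals. The linear coefficient 1/2 - κ
is chosen so that its own -(1/2 - κ) d cancels both, leaving the constant (1/2 - κ) λ_tot instead of
a term in d. -/
theorem integral_lyap_step_le [IsProbabilityMeasure P] (X : OnOffSystem P p lam) (t : ℕ) {z κ : ℝ}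
    (h0 : 0 ≤ z) (h1 : z ≤ 1) (hκ : ∀ i, κ ≤ z * lam i + (1 - z) * ∑ j, lam j)
    {q s m : Fin N → ℕ} (hs : ∀ i, s i ≤ 1) (h : IsLongestConnected q s m) :
    ∫ ω, lyap z (1 / 2 - κ) (q - m + X.arr t ω) ∂P ≤
      lyap z (1 / 2 - κ) q - servedWeight z q s + gram z (castVec q) lam +
        ((1 / 2 - κ) * (∑ i, lam i) +
          1 / 2 * ∫ ω, gram z (castVec (X.arr 0 ω)) (castVec (X.arr 0 ω)) ∂P) := by
  obtain ⟨i, hsub, hi⟩ := h.sub_eq hs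
  have hG := IsLongestConnected.gram_single_eq z hi
  have hd := sq_min_one (maxConn q s)
  have hd0 : (0 : ℝ) ≤ (min (maxConn q s) 1 : ℕ) := Nat.cast_nonneg _
  rw [X.integral_lyap_add t h0 h1]
  have hx : ∑ j, ((q - m) j : ℝ) = (∑ j, (q j : ℝ)) - (min (maxConn q s) 1 : ℕ) := by
    have := sum_sub_single (castVec q) i ((min (maxConn q s) 1 : ℕ) : ℝ)
    rw [← hsub] at this
    exact this
  generalize ((min (maxConn q s) 1 : ℕ) : ℝ) = d at *
  have e1 : lyap z (1 / 2 - κ) (q - m) =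
      lyap z (1 / 2 - κ) q - servedWeight z q s + κ * d := by
    unfold lyap
    rw [hx, hsub, gram_sub_left, gram_sub_right, gram_sub_right, gram_comm z (Pi.single i d), hG,
      gram_single_right, Finset.sum_pi_single']
    simp only [Pi.single_eq_same, Finset.mem_univ, if_true]
    have : (z * d + (1 - z) * d) * d = d := by linear_combination hd
    rw [this]
    ring
  have e2 : gram z (castVec (q - m)) lam ≤ gram z (castVec q) lam - κ * d := by
    rw [hsub, gram_sub_left, gram_comm z (Pi.single i d), gram_single_right]
    linarith [mul_le_mul_of_nonneg_right (hκ i) hd0]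
  rw [e1]
  linarith

theorem gram_lam_le {z r ε : ℝ} (hlam : ∀ i, z * lam i + (1 - z) * ∑ j, lam j + ε ≤ r)
    (q : Fin N → ℕ) : gram z (castVec q) lam ≤ (∑ i, (q i : ℝ)) * r - ε * ∑ i, (q i : ℝ) := by
  rw [gram_comm, gram_eq_sum, Finset.sum_mul, Finset.mul_sum _ _ ε, ← Finset.sum_sub_distrib]
  refine Finset.sum_le_sum fun i _ => ?_
  have := mul_le_mul_of_nonneg_right (hlam i) (Nat.cast_nonneg (α := ℝ) (q i))
  simp only [castVec]
  linarith

theorem lintegral_init_lt_top [IsProbabilityMeasure P] (X : OnOffSystem P p lam)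
    {f : (Fin N → ℕ) → ℝ} {k : ℝ} (hf : ∀ q, f q ≤ k * (1 + (∑ i, (q i : ℝ)) ^ 2)) :
    ∫⁻ ω, ENNReal.ofReal (f (X.queue 0 ω)) ∂P ≠ ∞ := by
  have hi : Integrable (fun ω => (∑ i, (X.init ω i : ℝ)) ^ 2) P :=
    (memLp_finsetSum (f := fun i ω => (X.init ω i : ℝ)) Finset.univ
      fun i _ => X.memLp_init i).integrable_sq
  have h2 := (((integrable_const (1 : ℝ)).add hi).const_mul k).lintegral_lt_top
  refine (lt_of_le_of_lt (lintegral_mono fun ω => ENNReal.ofReal_le_ofReal ?_) h2).ne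
  exact hf (X.init ω)

theorem lyap_le {N : ℕ} {z c : ℝ} (h0 : 0 ≤ z) (q : Fin N → ℕ) :
    lyap z c q ≤ (1 + |c|) * (1 + (∑ i, (q i : ℝ)) ^ 2) := by
  have h1 := gram_self_le h0 (castVec_nonneg q)
  simp only [castVec] at h1
  have h2 : c * ∑ i, (q i : ℝ) ≤ |c| * (1 + (∑ i, (q i : ℝ)) ^ 2) :=
    mul_le_mul (le_abs_self c) (by nlinarith [sq_nonneg (∑ i, (q i : ℝ) - 1)])
      (by positivity) (abs_nonneg c)
  unfold lyap
  nlinarith [sq_nonneg (∑ i, (q i : ℝ))]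

/-- The expected total backlogs are summable up to a linear error term. -/
theorem sum_lintegral_queue_le [IsProbabilityMeasure P] (X : OnOffSystem P p lam) (hX : X.IsLCQ)
    (hN : 0 < N) {z κ r ε C : ℝ} (h0 : 0 ≤ z) (h1 : z ≤ 1) (hκ1 : κ ≤ 1)
    (hκ : ∀ i, κ ≤ z * lam i + (1 - z) * ∑ j, lam j) (hε : 0 < ε)
    (hlam : ∀ i, z * lam i + (1 - z) * ∑ j, lam j + ε ≤ r)
    (hr : ∀ t q, (∑ i, (q i : ℝ)) * r ≤ ∫ ω, servedWeight z q (X.chan t ω) ∂P)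
    (hC : C = (1 / 2 - κ) * (∑ i, lam i) +
      1 / 2 * ∫ ω, gram z (castVec (X.arr 0 ω)) (castVec (X.arr 0 ω)) ∂P) :
    ∃ a : ℝ≥0∞, a ≠ ∞ ∧ ∀ t : ℕ, ∑ τ ∈ Finset.range t, ∫⁻ ω, ∑ i, (X.queue τ ω i : ℝ≥0∞) ∂P ≤
      a + t * ENNReal.ofReal (C / ε) := by
  have hstep : ∀ t, (∫⁻ ω, ENNReal.ofReal (lyap z (1 / 2 - κ) (X.queue (t + 1) ω)) ∂P) +
      (ENNReal.ofReal ε * ∫⁻ ω, ∑ i, (X.queue t ω i : ℝ≥0∞) ∂P) ≤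
      (∫⁻ ω, ENNReal.ofReal (lyap z (1 / 2 - κ) (X.queue t ω)) ∂P) + ENNReal.ofReal C := by
    intro t
    have h := X.lintegral_step_le hX hN t (lyap z (1 / 2 - κ))
      (fun x => lyap_nonneg h1 (by linarith) x) (X.integrable_lyap_add t h0 h1 _)
      (fun q s => lyap z (1 / 2 - κ) q - servedWeight z q s + gram z (castVec q) lam + C)
      (fun q => lyap z (1 / 2 - κ) q + C) (fun q => ε * ∑ i, (q i : ℝ))
      (fun q => by positivity)
      (fun q s m hs hm => by rw [hC]; exact X.integral_lyap_step_le t h0 h1 hκ hs hm)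
      (fun q => by
        have e : ∀ ω, lyap z (1 / 2 - κ) q - servedWeight z q (X.chan t ω) +
            gram z (castVec q) lam + C = (lyap z (1 / 2 - κ) q + gram z (castVec q) lam + C) -
              servedWeight z q (X.chan t ω) := fun ω => by ring
        simp only [e]
        rw [integral_sub (integrable_const _) (X.integrable_chan t (servedWeight z q)),
          integral_const, probReal_univ, one_smul]
        linarith [gram_lam_le hlam q, hr t q])
      (fun _ => 1) (fun _ _ _ => rfl)
    simp only [one_mul] at h
    have e2 : ∫⁻ ω, ENNReal.ofReal (ε * ∑ i, (X.queue t ω i : ℝ)) ∂P =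
        ENNReal.ofReal ε * ∫⁻ ω, ∑ i, (X.queue t ω i : ℝ≥0∞) ∂P := by
      have hm : Measurable fun ω => ∑ i, (X.queue t ω i : ℝ≥0∞) :=
        (measurable_of_countable fun q : Fin N → ℕ => ∑ i, (q i : ℝ≥0∞)).comp (X.measurable_queue t)
      rw [← lintegral_const_mul _ hm]
      refine lintegral_congr fun ω => ?_
      rw [ENNReal.ofReal_mul hε.le, ENNReal.ofReal_sum_of_nonneg fun i _ => Nat.cast_nonneg _]
      simp
    rw [e2] at h
    refine h.trans ((lintegral_mono fun ω => ENNReal.ofReal_add_le).trans ?_)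
    rw [lintegral_add_right _ measurable_const, lintegral_const, measure_univ, mul_one]
  have hsum := add_sum_range_le_of_step hstep
  have hε' : ENNReal.ofReal ε ≠ 0 := by simpa using hε
  refine ⟨(∫⁻ ω, ENNReal.ofReal (lyap z (1 / 2 - κ) (X.queue 0 ω)) ∂P) / ENNReal.ofReal ε,
    ENNReal.div_ne_top (X.lintegral_init_lt_top fun q => lyap_le h0 q) hε', fun t => ?_⟩
  -- The Lyapunov value at time t is nonnegative and is discarded from the telescoped inequality.
  have h2 := le_add_self.trans (hsum t)
  rw [← Finset.mul_sum, Finset.sum_const, Finset.card_range, nsmul_eq_mul] at h2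
  rw [ENNReal.ofReal_div_of_pos hε, ← mul_div_assoc, ← ENNReal.add_div,
    ENNReal.le_div_iff_mul_le (Or.inl hε') (Or.inl ENNReal.ofReal_ne_top), mul_comm]
  exact h2

end OnOffSystem

/-! ### A Lyapunov function of linear growth -/

section GramNorm

variable {N : ℕ}

/-- The norm of the quadratic form. -/
noncomputable def gramNorm (z : ℝ) (x : Fin N → ℝ) : ℝ := √(gram z x x)

/-- An isometric embedding into a Euclidean space. -/
noncomputable def gramEmbed (z : ℝ) (x : Fin N → ℝ) : EuclideanSpace ℝ (Option (Fin N)) :=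
  WithLp.toLp 2 fun o => o.elim (√(1 - z) * ∑ i, x i) fun i => √z * x i

theorem gramEmbed_add (z : ℝ) (x y : Fin N → ℝ) :
    gramEmbed z (x + y) = gramEmbed z x + gramEmbed z y := by
  ext o
  cases o <;> simp [gramEmbed, Finset.sum_add_distrib, mul_add]

theorem norm_gramEmbed {z : ℝ} (h0 : 0 ≤ z) (h1 : z ≤ 1) (x : Fin N → ℝ) :
    ‖gramEmbed z x‖ = gramNorm z x := by
  rw [EuclideanSpace.norm_eq, Fintype.sum_option, gramNorm]
  congr 1
  simp only [gramEmbed, Option.elim, Real.norm_eq_abs, sq_abs, mul_pow, Real.sq_sqrt h0,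
    Real.sq_sqrt (by linarith : 0 ≤ 1 - z), ← Finset.mul_sum, gram]
  simp only [pow_two]
  ring

theorem gramNorm_add_le {z : ℝ} (h0 : 0 ≤ z) (h1 : z ≤ 1) (x y : Fin N → ℝ) :
    gramNorm z (x + y) ≤ gramNorm z x + gramNorm z y := by
  simp only [← norm_gramEmbed h0 h1, gramEmbed_add]
  exact norm_add_le _ _

theorem gramNorm_neg (z : ℝ) (x : Fin N → ℝ) : gramNorm z (-x) = gramNorm z x := by
  simp [gramNorm, gram]

theorem gramNorm_nonneg (z : ℝ) (x : Fin N → ℝ) : 0 ≤ gramNorm z x := Real.sqrt_nonneg _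

theorem gramNorm_le_sum {z : ℝ} (h0 : 0 ≤ z) {x : Fin N → ℝ} (hx : 0 ≤ x) :
    gramNorm z x ≤ ∑ i, x i :=
  Real.sqrt_le_iff.2 ⟨Finset.sum_nonneg fun i _ => hx i, gram_self_le h0 hx⟩

theorem gramNorm_sq {z : ℝ} (h0 : 0 ≤ z) (h1 : z ≤ 1) {x : Fin N → ℝ} (hx : 0 ≤ x) :
    gramNorm z x ^ 2 = gram z x x := Real.sq_sqrt (gram_nonneg h0 h1 hx hx)

theorem sum_le_mul_gramNorm {z : ℝ} (h1 : z ≤ 1) {x : Fin N → ℝ} (hx : 0 ≤ x) :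
    ∑ i, x i ≤ N * gramNorm z x := by
  have h : ∀ i ∈ Finset.univ, x i ≤ gramNorm z x := fun i hi => by
    refine Real.le_sqrt_of_sq_le (le_trans ?_ (sum_mul_self_le_gram h1 hx))
    rw [pow_two]
    exact Finset.single_le_sum (f := fun i => x i * x i) (fun j _ => mul_self_nonneg _) hi
  simpa using Finset.sum_le_card_nsmul _ _ _ h

theorem abs_gramNorm_add_sub_le {z : ℝ} (h0 : 0 ≤ z) (h1 : z ≤ 1) (x y : Fin N → ℝ) :
    |gramNorm z (x + y) - gramNorm z x| ≤ gramNorm z y := by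
  rw [abs_le]
  constructor
  · have := gramNorm_add_le h0 h1 (x + y) (-y)
    rw [add_neg_cancel_right, gramNorm_neg] at this
    linarith
  · linarith [gramNorm_add_le h0 h1 x y]

/-- The tangent line of the square root at ν², which lies above the graph by concavity. -/
theorem sqrt_sq_add_le {ν y : ℝ} (hν : 0 < ν) (h : 0 ≤ ν ^ 2 + y) :
    √(ν ^ 2 + y) ≤ ν + y / (2 * ν) := by
  refine Real.sqrt_le_iff.2 ⟨?_, ?_⟩
  · have : ν + y / (2 * ν) = (2 * ν ^ 2 + y) / (2 * ν) := by field_simp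
    rw [this]
    exact div_nonneg (by nlinarith [sq_nonneg ν]) (by linarith)
  · have : (ν + y / (2 * ν)) ^ 2 = ν ^ 2 + y + (y / (2 * ν)) ^ 2 := by field_simp; ring
    rw [this]
    linarith [sq_nonneg (y / (2 * ν))]

end GramNorm

namespace OnOffSystem

/-- A Lyapunov function of linear growth that decreases on average from every nonzero state. -/
noncomputable def linLyap {N : ℕ} (z Γ θ : ℝ) (q : Fin N → ℕ) : ℝ :=
  gramNorm z (castVec q) + Γ * (1 - θ ^ ∑ i, q i)

section

variable {N : ℕ} {z Γ θ : ℝ}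

theorem gramNorm_le_linLyap (hΓ : 0 ≤ Γ) (hθ0 : 0 ≤ θ) (hθ1 : θ ≤ 1) (q : Fin N → ℕ) :
    gramNorm z (castVec q) ≤ linLyap z Γ θ q :=
  le_add_of_nonneg_right (mul_nonneg hΓ (by linarith [pow_le_one₀ (n := ∑ i, q i) hθ0 hθ1]))

theorem linLyap_le (h0 : 0 ≤ z) (hΓ : 0 ≤ Γ) (hθ0 : 0 ≤ θ) (q : Fin N → ℕ) :
    linLyap z Γ θ q ≤ ∑ i, (q i : ℝ) + Γ := by
  have h1 := gramNorm_le_sum h0 (castVec_nonneg q)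
  have h2 : Γ * (1 - θ ^ ∑ i, q i) ≤ Γ * 1 := by
    refine mul_le_mul_of_nonneg_left ?_ hΓ
    have : 0 ≤ θ ^ ∑ i, q i := by positivity
    linarith
  simp only [castVec] at h1
  unfold linLyap
  linarith

theorem linLyap_zero : linLyap z Γ θ (0 : Fin N → ℕ) = 0 := by
  have : castVec (0 : Fin N → ℕ) = 0 := by ext; simp [castVec]
  simp [linLyap, this, gramNorm, gram]

theorem castVec_sub_add {q m a : Fin N → ℕ} {i : Fin N} {d : ℝ}
    (h : castVec (q - m) = castVec q - Pi.single i d) :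
    castVec (q - m + a) = castVec q + (castVec a - Pi.single i d) := by
  rw [castVec_add, h]; abel

theorem abs_linLyap_sub_le (h0 : 0 ≤ z) (h1 : z ≤ 1) (hΓ : 0 ≤ Γ) (hθ0 : 0 ≤ θ) (hθ1 : θ ≤ 1)
    {q s m : Fin N → ℕ} (hs : ∀ i, s i ≤ 1) (h : IsLongestConnected q s m) (a : Fin N → ℕ) :
    |linLyap z Γ θ (q - m + a) - linLyap z Γ θ q| ≤ (1 + Γ) * (1 + ∑ i, (a i : ℝ)) := by
  obtain ⟨i, hsub, -⟩ := h.sub_eq hs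
  have hd0 : (0 : ℝ) ≤ (min (maxConn q s) 1 : ℕ) := Nat.cast_nonneg _
  have hd1 : ((min (maxConn q s) 1 : ℕ) : ℝ) ≤ 1 := by exact_mod_cast min_le_right _ _
  generalize ((min (maxConn q s) 1 : ℕ) : ℝ) = d at *
  have ha : 0 ≤ ∑ i, (a i : ℝ) := by positivity
  have e1 : |gramNorm z (castVec (q - m + a)) - gramNorm z (castVec q)| ≤ 1 + ∑ i, (a i : ℝ) := by
    rw [castVec_sub_add hsub]
    refine (abs_gramNorm_add_sub_le h0 h1 _ _).trans ?_
    rw [sub_eq_add_neg]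
    refine (gramNorm_add_le h0 h1 _ _).trans ?_
    rw [gramNorm_neg, add_comm]
    refine add_le_add ((gramNorm_le_sum h0 (Pi.single_nonneg.2 hd0)).trans ?_)
      (gramNorm_le_sum h0 (castVec_nonneg a))
    rw [Finset.sum_pi_single']
    simpa using hd1
  have e2 : ∀ n k : ℕ, |Γ * (1 - θ ^ n) - Γ * (1 - θ ^ k)| ≤ Γ := fun n k => by
    have a1 := pow_le_one₀ (n := n) hθ0 hθ1
    have a2 := pow_le_one₀ (n := k) hθ0 hθ1
    have a3 : 0 ≤ θ ^ n := by positivity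
    have a4 : 0 ≤ θ ^ k := by positivity
    rw [← mul_sub, abs_mul, abs_of_nonneg hΓ]
    refine mul_le_of_le_one_right hΓ (abs_le.2 ⟨by linarith, by linarith⟩)
  have e3 := e2 (∑ i, (q - m + a) i) (∑ i, q i)
  have : linLyap z Γ θ (q - m + a) - linLyap z Γ θ q =
      (gramNorm z (castVec (q - m + a)) - gramNorm z (castVec q)) +
      (Γ * (1 - θ ^ ∑ i, (q - m + a) i) - Γ * (1 - θ ^ ∑ i, q i)) := by
    unfold linLyap; ring
  rw [this]
  refine (abs_add_le _ _).trans ?_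
  nlinarith

/-- Pathwise bound on the change of the Lyapunov function of linear growth. -/
theorem linLyap_step_le (h0 : 0 ≤ z) (h1 : z ≤ 1) (hΓ : 0 ≤ Γ) (hθ0 : 0 ≤ θ)
    {q s m : Fin N → ℕ} (hs : ∀ i, s i ≤ 1) (h : IsLongestConnected q s m) (hq : q ≠ 0)
    (a : Fin N → ℕ) : linLyap z Γ θ (q - m + a) ≤ gramNorm z (castVec q) +
      (gram z (castVec q) (castVec a) - servedWeight z q s + 1 / 2 * ((∑ i, (a i : ℝ)) ^ 2 + 1)) /
        gramNorm z (castVec q) + Γ * (1 - θ ^ (∑ i, (q - m) i) * (1 - ∑ i, (a i : ℝ))) := by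
  obtain ⟨i, hsub, hi⟩ := h.sub_eq hs
  have hG := IsLongestConnected.gram_single_eq z hi
  have hd := sq_min_one (maxConn q s)
  have hd0 : (0 : ℝ) ≤ (min (maxConn q s) 1 : ℕ) := Nat.cast_nonneg _
  have hd1 : ((min (maxConn q s) 1 : ℕ) : ℝ) ≤ 1 := by exact_mod_cast min_le_right _ _
  generalize ((min (maxConn q s) 1 : ℕ) : ℝ) = d at *
  have hν : 0 < gramNorm z (castVec q) := by
    obtain ⟨j, hj⟩ := Function.ne_iff.1 hq
    have hj' : (1 : ℝ) ≤ q j := by exact_mod_cast Nat.one_le_iff_ne_zero.2 hj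
    have : (q j : ℝ) ≤ ∑ i, (q i : ℝ) :=
      Finset.single_le_sum (f := fun i => (q i : ℝ)) (fun _ _ => Nat.cast_nonneg _)
        (Finset.mem_univ j)
    exact Real.sqrt_pos.2 (by linarith [sum_le_gram_self h1 q])
  have hνsq := gramNorm_sq h0 h1 (castVec_nonneg q)
  -- The cross term has a favourable sign and is dropped; the form of the service vector is d² = d ≤
  -- 1.
  have hgs : gram z (castVec a - Pi.single i d) (castVec a - Pi.single i d) ≤
      (∑ i, (a i : ℝ)) ^ 2 + 1 := by
    have k1 := gram_self_le h0 (castVec_nonneg a)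
    have k2 : 0 ≤ gram z (castVec a) (Pi.single i d) :=
      gram_nonneg h0 h1 (castVec_nonneg a) (Pi.single_nonneg.2 hd0)
    have k3 : gram z (Pi.single i d) (Pi.single i d) = d := by
      rw [gram_single_right, Finset.sum_pi_single']
      simp only [Pi.single_eq_same, Finset.mem_univ, if_true]
      linear_combination hd
    rw [gram_sub_left, gram_sub_right, gram_sub_right, gram_comm z (Pi.single i d) (castVec a), k3]
    simp only [castVec] at k1 k2 ⊢
    linarith
  have hnorm : gramNorm z (castVec (q - m + a)) ≤ gramNorm z (castVec q) +
      (gram z (castVec q) (castVec a) - servedWeight z q s + 1 / 2 * ((∑ i, (a i : ℝ)) ^ 2 + 1)) /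
        gramNorm z (castVec q) := by
    have e : gram z (castVec (q - m + a)) (castVec (q - m + a)) = gramNorm z (castVec q) ^ 2 +
        (2 * (gram z (castVec q) (castVec a) - servedWeight z q s) +
          gram z (castVec a - Pi.single i d) (castVec a - Pi.single i d)) := by
      rw [castVec_sub_add hsub, hνsq, gram_add_left, gram_add_right, gram_add_right,
        gram_comm z (castVec a - (Pi.single i d : Fin N → ℝ)) (castVec q), gram_sub_right z (castVec q), hG]
      ring
    have e0 := gram_nonneg h0 h1 (castVec_nonneg (q - m + a)) (castVec_nonneg (q - m + a))
    rw [e] at e0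
    have e1 := sqrt_sq_add_le hν e0
    rw [← e] at e1
    refine e1.trans (add_le_add_right ?_ _)
    rw [div_le_div_iff₀ (by linarith) hν]
    nlinarith
  -- This is θ^k ≥ 1 - k for the number k of arrivals: an equality at k = 0, and trivial for k ≥ 1.
  -- Only slots without arrivals are exploited, which is enough because λ_tot < 1 in the
  -- application.
  have hpow : θ ^ (∑ i, (q - m) i) * (1 - ∑ i, (a i : ℝ)) ≤ θ ^ ∑ i, (q - m + a) i := by
    have e : ∑ i, (q - m + a) i = (∑ i, (q - m) i) + ∑ i, a i := by
      simp [Finset.sum_add_distrib]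
    have hp : 0 ≤ θ ^ (∑ i, (q - m) i) := by positivity
    rw [e, pow_add]
    refine mul_le_mul_of_nonneg_left ?_ hp
    rcases Nat.eq_zero_or_pos (∑ i, a i) with h' | h'
    · have : ∑ i, (a i : ℝ) = 0 := by exact_mod_cast h'
      rw [h', this]; simp
    · have : (1 : ℝ) ≤ ∑ i, (a i : ℝ) := by exact_mod_cast h'
      have : 0 ≤ θ ^ (∑ i, a i) := by positivity
      linarith
  unfold linLyap
  have := mul_le_mul_of_nonneg_left hpow hΓ
  linarith

theorem le_pow_sum_sub {q s m : Fin N → ℕ} (hθ0 : 0 ≤ θ) (hs : ∀ i, s i ≤ 1)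
    (h : IsLongestConnected q s m) :
    θ ^ ((∑ i, q i) - 1) * (min (maxConn q s) 1 : ℕ) ≤ θ ^ ∑ i, (q - m) i := by
  obtain ⟨i, hsub, -⟩ := h.sub_eq hs
  have hx : ((∑ j, (q - m) j : ℕ) : ℝ) = ((∑ j, q j : ℕ) : ℝ) - (min (maxConn q s) 1 : ℕ) := by
    have := sum_sub_single (castVec q) i ((min (maxConn q s) 1 : ℕ) : ℝ)
    rw [← hsub] at this
    simpa [castVec] using this
  have hx' : (∑ j, (q - m) j) + min (maxConn q s) 1 = ∑ j, q j := by
    have : ((∑ j, (q - m) j : ℕ) : ℝ) + (min (maxConn q s) 1 : ℕ) = ((∑ j, q j : ℕ) : ℝ) := by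
      linarith
    exact_mod_cast this
  rcases Nat.le_one_iff_eq_zero_or_eq_one.1 (min_le_right (maxConn q s) 1) with h' | h'
  · rw [h']; simp; positivity
  · rw [h'] at hx' ⊢
    rw [← hx']
    simp

end

variable {Ω : Type*} [MeasurableSpace Ω] {P : Measure Ω} {N : ℕ} {p lam : Fin N → ℝ}

/-- Upper bound on the conditional mean of `linLyap` after a slot, given the channel states. -/
noncomputable def linLyapStep (lam : Fin N → ℝ) (z Γ θ C : ℝ) (q s : Fin N → ℕ) : ℝ :=
  gramNorm z (castVec q) +
    (gram z (castVec q) lam - servedWeight z q s + C) / gramNorm z (castVec q) +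
    Γ * (1 - (1 - ∑ i, lam i) * (θ ^ ((∑ i, q i) - 1) * (min (maxConn q s) 1 : ℕ)))

theorem integrable_of_le_linear [IsProbabilityMeasure P] (X : OnOffSystem P p lam) (t : ℕ)
    {F : (Fin N → ℕ) → ℝ} {k : ℝ} (hF : ∀ x, 0 ≤ F x) (hk : 0 ≤ k)
    (hFk : ∀ x, F x ≤ k * (1 + ∑ i, (x i : ℝ)) ^ 2) (x : Fin N → ℕ) :
    Integrable (fun ω => F (x + X.arr t ω)) P := by
  refine X.integrable_arr t (f := fun a => F (x + a)) (k := k * (2 * (1 + ∑ i, (x i : ℝ)) ^ 2))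
    fun a => ?_
  rw [abs_of_nonneg (hF _)]
  refine (hFk _).trans ?_
  rw [mul_assoc]
  refine mul_le_mul_of_nonneg_left ?_ hk
  simp only [Pi.add_apply, Nat.cast_add, Finset.sum_add_distrib]
  have h1 : 0 ≤ ∑ i, (x i : ℝ) := by positivity
  have h2 : 0 ≤ ∑ i, (a i : ℝ) := by positivity
  generalize ∑ i, (x i : ℝ) = u at *
  generalize ∑ i, (a i : ℝ) = v at *
  have h3 : 1 + (u + v) ≤ (1 + u) * (1 + v) := by nlinarith
  calc (1 + (u + v)) ^ 2 ≤ ((1 + u) * (1 + v)) ^ 2 := by gcongr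
    _ = (1 + u) ^ 2 * (1 + v) ^ 2 := by ring
    _ ≤ (1 + u) ^ 2 * (2 * (1 + v ^ 2)) := by gcongr; nlinarith [sq_nonneg (1 - v)]
    _ = _ := by ring

theorem integral_linLyap_step_le [IsProbabilityMeasure P] (X : OnOffSystem P p lam) (t : ℕ)
    {z Γ θ : ℝ} (h0 : 0 ≤ z) (h1 : z ≤ 1) (hΓ : 0 ≤ Γ) (hθ0 : 0 ≤ θ) (hθ1 : θ ≤ 1)
    (hload : ∑ i, lam i ≤ 1) {q s m : Fin N → ℕ} (hs : ∀ i, s i ≤ 1)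
    (h : IsLongestConnected q s m) (hq : q ≠ 0) :
    ∫ ω, linLyap z Γ θ (q - m + X.arr t ω) ∂P ≤ linLyapStep lam z Γ θ
      (1 / 2 * (∫ ω, (∑ i, (X.arr 0 ω i : ℝ)) ^ 2 ∂P + 1)) q s := by
  set ν := gramNorm z (castVec q) with hν
  set θx := θ ^ (∑ i, (q - m) i) with hθx
  have i1 := X.integrable_sum_mul_arr t fun i =>
    (z * castVec q i + (1 - z) * ∑ j, castVec q j) / ν + Γ * θx
  have i2 := (X.integrable_sum_arr_sq t).const_mul (1 / 2 / ν)
  have i3 : Integrable (fun _ : Ω => ν + (1 / 2 - servedWeight z q s) / ν + Γ * (1 - θx)) P :=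
    integrable_const _
  have i4 : Integrable (fun ω => (ν + (1 / 2 - servedWeight z q s) / ν + Γ * (1 - θx)) +
    ∑ i, ((z * castVec q i + (1 - z) * ∑ j, castVec q j) / ν + Γ * θx) * (X.arr t ω i : ℝ)) P :=
    i3.add i1
  have hsplit : ∀ y : Fin N → ℝ,
      ∑ i, ((z * castVec q i + (1 - z) * ∑ j, castVec q j) / ν + Γ * θx) * y i =
      gram z (castVec q) y / ν + Γ * θx * ∑ i, y i := fun y => by
    rw [gram_eq_sum, Finset.sum_div, Finset.mul_sum _ _ (Γ * θx), ← Finset.sum_add_distrib]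
    exact Finset.sum_congr rfl fun i _ => by ring
  calc ∫ ω, linLyap z Γ θ (q - m + X.arr t ω) ∂P
      ≤ ∫ ω, ((ν + (1 / 2 - servedWeight z q s) / ν + Γ * (1 - θx)) +
        ∑ i, ((z * castVec q i + (1 - z) * ∑ j, castVec q j) / ν + Γ * θx) * (X.arr t ω i : ℝ) +
        1 / 2 / ν * (∑ i, (X.arr t ω i : ℝ)) ^ 2) ∂P := by
        refine integral_mono (X.integrable_of_le_linear t (k := 1 + Γ)
          (fun x => (gramNorm_nonneg _ _).trans (gramNorm_le_linLyap hΓ hθ0 hθ1 x))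
          (by linarith) (fun x => ?_) _) (i4.add i2) fun ω => ?_
        · refine (linLyap_le h0 hΓ hθ0 x).trans ?_
          have : 0 ≤ ∑ i, (x i : ℝ) := by positivity
          nlinarith [mul_nonneg hΓ this, sq_nonneg (∑ i, (x i : ℝ)),
            mul_nonneg hΓ (sq_nonneg (∑ i, (x i : ℝ)))]
        · refine (linLyap_step_le h0 h1 hΓ hθ0 hs h hq (X.arr t ω)).trans (le_of_eq ?_)
          have := hsplit (castVec (X.arr t ω))
          simp only [castVec] at this ⊢
          rw [this, ← hθx, ← hν]
          ring
    _ = (ν + (1 / 2 - servedWeight z q s) / ν + Γ * (1 - θx)) +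
        (gram z (castVec q) lam / ν + Γ * θx * ∑ i, lam i) +
        1 / 2 / ν * ∫ ω, (∑ i, (X.arr 0 ω i : ℝ)) ^ 2 ∂P := by
        rw [integral_add i4 i2, integral_add i3 i1, integral_const_mul, X.integral_sum_mul_arr,
          hsplit, X.integral_arr t fun a => (∑ i, (a i : ℝ)) ^ 2]
        simp
    _ ≤ _ := by
        have h2 := mul_le_mul_of_nonneg_left (mul_le_mul_of_nonneg_left
          (le_pow_sum_sub hθ0 hs h) (by linarith : 0 ≤ 1 - ∑ i, lam i)) hΓ
        rw [← hθx] at h2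
        have h3 : (1 / 2 - servedWeight z q s) / ν + gram z (castVec q) lam / ν +
            1 / 2 / ν * ∫ ω, (∑ i, (X.arr 0 ω i : ℝ)) ^ 2 ∂P =
            (gram z (castVec q) lam - servedWeight z q s +
              1 / 2 * (∫ ω, (∑ i, (X.arr 0 ω i : ℝ)) ^ 2 ∂P + 1)) / ν := by ring
        unfold linLyapStep
        rw [← hν]
        linarith

/-- Let ν be the norm of the state. The norm alone has drift at most -ε + C/ν, which is good once ν
≥ 2C/ε. The bounded term always has drift at most -Γ θ^(∑ q_i). On the remaining states ∑ q_i ≤ ν² ≤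
n₀, so the choice Γ = C/θ^n₀ makes this gain at least C ≥ C/ν. -/
theorem integral_linLyapStep_le [IsProbabilityMeasure P] (X : OnOffSystem P p lam) (t : ℕ)
    {z r ε C Γ θ : ℝ} {n₀ : ℕ} (h0 : 0 ≤ z) (h1 : z ≤ 1) (hε : 0 < ε)
    (hlam : ∀ i, z * lam i + (1 - z) * ∑ j, lam j + ε ≤ r)
    (hr : ∀ t q, (∑ i, (q i : ℝ)) * r ≤ ∫ ω, servedWeight z q (X.chan t ω) ∂P)
    (hC : 0 ≤ C) (hn₀ : (2 * C / ε) ^ 2 ≤ n₀) (hθ0 : 0 < θ) (hθ1 : θ ≤ 1)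
    (hθ : 2 * θ ≤ (1 - ∑ i, lam i) * pMin p) (hload : ∑ i, lam i ≤ 1) (hΓ : Γ = C / θ ^ n₀)
    {q : Fin N → ℕ} (hq : q ≠ 0) :
    ∫ ω, linLyapStep lam z Γ θ C q (X.chan t ω) ∂P ≤ linLyap z Γ θ q - ε / 2 := by
  have hΓ0 : 0 ≤ Γ := by rw [hΓ]; positivity
  have hn1 : (1 : ℝ) ≤ ∑ i, (q i : ℝ) := by
    obtain ⟨j, hj⟩ := Function.ne_iff.1 hq
    have hj' : (1 : ℝ) ≤ q j := by exact_mod_cast Nat.one_le_iff_ne_zero.2 hj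
    exact hj'.trans (Finset.single_le_sum (f := fun i => (q i : ℝ))
      (fun _ _ => Nat.cast_nonneg _) (Finset.mem_univ j))
  have hνsq := gramNorm_sq h0 h1 (castVec_nonneg q)
  have hnν := sum_le_gram_self h1 q
  have hνn : gramNorm z (castVec q) ≤ ∑ i, (q i : ℝ) := gramNorm_le_sum h0 (castVec_nonneg q)
  have hν1 : 1 ≤ gramNorm z (castVec q) := by
    rw [gramNorm, Real.one_le_sqrt]; linarith
  have hgr := gram_lam_le hlam q
  have hrq := hr t q
  have hdq := X.le_integral_min_maxConn t hq
  have key : ∫ ω, linLyapStep lam z Γ θ C q (X.chan t ω) ∂P = gramNorm z (castVec q) +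
      (gram z (castVec q) lam - (∫ ω, servedWeight z q (X.chan t ω) ∂P) + C) /
        gramNorm z (castVec q) + Γ * (1 - (1 - ∑ i, lam i) * (θ ^ ((∑ i, q i) - 1) *
          ∫ ω, ((min (maxConn q (X.chan t ω)) 1 : ℕ) : ℝ) ∂P)) := by
    have i1 := X.integrable_chan t fun s => -(1 / gramNorm z (castVec q)) * servedWeight z q s
    have i2 := X.integrable_chan t fun s => -(Γ * (1 - ∑ i, lam i) * θ ^ ((∑ i, q i) - 1)) *
      ((min (maxConn q s) 1 : ℕ) : ℝ)
    have i3 : Integrable (fun _ : Ω => gramNorm z (castVec q) + (gram z (castVec q) lam + C) /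
      gramNorm z (castVec q) + Γ) P := integrable_const _
    have i4 : Integrable (fun ω => (gramNorm z (castVec q) + (gram z (castVec q) lam + C) /
      gramNorm z (castVec q) + Γ) +
        -(1 / gramNorm z (castVec q)) * servedWeight z q (X.chan t ω)) P := i3.add i1
    calc _ = ∫ ω, ((gramNorm z (castVec q) + (gram z (castVec q) lam + C) /
          gramNorm z (castVec q) + Γ) +
          -(1 / gramNorm z (castVec q)) * servedWeight z q (X.chan t ω) +
          -(Γ * (1 - ∑ i, lam i) * θ ^ ((∑ i, q i) - 1)) *
            ((min (maxConn q (X.chan t ω)) 1 : ℕ) : ℝ)) ∂P := by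
          refine integral_congr_ae (ae_of_all _ fun ω => ?_)
          simp only [linLyapStep]
          ring
      _ = _ := by
          rw [integral_add i4 i2, integral_add i3 i1, integral_const_mul, integral_const_mul]
          simp only [integral_const, probReal_univ, one_smul]
          ring
  rw [key]
  generalize (∫ ω, servedWeight z q (X.chan t ω) ∂P) = G at *
  generalize (∫ ω, ((min (maxConn q (X.chan t ω)) 1 : ℕ) : ℝ) ∂P) = d at *
  unfold linLyap
  have hN1 : 1 ≤ ∑ i, q i := by exact_mod_cast hn1
  -- From a nonzero state the mean of θ^(next backlog) is at least (1 - λ_tot) p_min θ^(n - 1) with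
  -- n = ∑ q_i. The smallness of θ makes this at least 2 θ^n, so the correction falls by at least Γ
  -- θ^n on average.
  have hpow : θ ^ (∑ i, q i) * 2 ≤ (1 - ∑ i, lam i) * (θ ^ ((∑ i, q i) - 1) * d) := by
    obtain ⟨k, hk⟩ := Nat.exists_eq_add_of_le' hN1
    rw [hk, Nat.add_sub_cancel, pow_succ]
    have hp : 0 ≤ θ ^ k := by positivity
    have := hθ.trans (mul_le_mul_of_nonneg_left hdq (by linarith : 0 ≤ 1 - ∑ i, lam i))
    nlinarith
  have hcast : ((∑ i, q i : ℕ) : ℝ) = ∑ i, (q i : ℝ) := by push_cast; rfl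
  generalize (∑ i, lam i) = l at *
  have h2 := mul_le_mul_of_nonneg_left hpow hΓ0
  generalize hν : gramNorm z (castVec q) = ν at *
  have h3 : (gram z (castVec q) lam - G + C) / ν ≤ -ε + C / ν := by
    rw [div_le_iff₀ (by linarith), add_mul, div_mul_cancel₀ _ (by linarith : ν ≠ 0)]
    nlinarith
  have h4 : C / ν ≤ ε / 2 + Γ * θ ^ (∑ i, q i) := by
    have hpn : 0 ≤ Γ * θ ^ (∑ i, q i) := by positivity
    rcases le_or_gt (2 * C / ε) ν with hc | hc
    · have : C / ν ≤ ε / 2 := by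
        rw [div_le_iff₀ hε] at hc
        rw [div_le_iff₀ (by linarith)]
        linarith
      linarith
    · have h5 : ∑ i, (q i : ℝ) ≤ n₀ := by
        refine le_trans ?_ hn₀
        have : ν ^ 2 ≤ (2 * C / ε) ^ 2 := by gcongr
        linarith
      have h6 : ∑ i, q i ≤ n₀ := by rw [← hcast] at h5; exact_mod_cast h5
      have h7 : θ ^ n₀ ≤ θ ^ (∑ i, q i) := pow_le_pow_of_le_one hθ0.le hθ1 h6
      have h8 : C ≤ Γ * θ ^ (∑ i, q i) := by
        calc C = Γ * θ ^ n₀ := by rw [hΓ]; field_simp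
          _ ≤ _ := by gcongr
      have h9 : C / ν ≤ C := div_le_self hC hν1
      linarith
  linarith

end OnOffSystem

/-! ### Drift functions and sublinear growth of second moments -/

theorem sq_posPart_add_le (x δ M : ℝ) :
    (max (x + δ - M) 0) ^ 2 ≤ (max (x - M) 0) ^ 2 + 2 * max (x - M) 0 * δ + δ ^ 2 := by
  rcases le_total (x + δ - M) 0 with h | h
  · rw [max_eq_right h]
    nlinarith [sq_nonneg (max (x - M) 0 + δ)]
  · rw [max_eq_left h]
    have h1 : 0 ≤ max (x - M) 0 := le_max_right _ _
    have h2 : x - M ≤ max (x - M) 0 := le_max_left _ _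
    nlinarith

/-- If neither x nor D exceeds M/2, then y ≤ x + D ≤ M and both positive parts vanish. Hence the
quadratic error D² is paid only when the state or the increment is large. -/
theorem sq_posPart_sub_le {x y D M : ℝ} (hM : 0 ≤ M) (h : |y - x| ≤ D) :
    (max (y - M) 0) ^ 2 ≤ (max (x - M) 0) ^ 2 + 2 * max (x - M) 0 * (y - x) +
      D ^ 2 * (if M / 2 < x then 1 else 0) + (if M / 2 < D then D ^ 2 else 0) := by
  have hD : 0 ≤ D := (abs_nonneg _).trans h
  have h1 := sq_posPart_add_le x (y - x) M
  rw [add_sub_cancel] at h1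
  have h2 : (y - x) ^ 2 ≤ D ^ 2 := sq_le_sq' (by linarith [neg_abs_le (y - x)])
    ((le_abs_self _).trans h)
  have h3 : 0 ≤ D ^ 2 := sq_nonneg D
  split_ifs with ha hb hb
  · linarith
  · linarith
  · linarith
  · have hy : y ≤ M := by linarith [(le_abs_self (y - x)).trans h]
    rw [max_eq_right (by linarith : y - M ≤ 0), max_eq_right (by linarith : x - M ≤ 0)]
    simp

namespace OnOffSystem

variable {Ω : Type*} [MeasurableSpace Ω] {P : Measure Ω} {N : ℕ} {p lam : Fin N → ℝ}

/-- `Ψ` has linear growth, bounded increments relative to the arrivals, and mean change at most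
`-η` in every slot of LCQ that starts with a nonzero backlog. -/
structure IsDriftFunction (X : OnOffSystem P p lam) (Ψ : (Fin N → ℕ) → ℝ)
    (g : (Fin N → ℕ) → (Fin N → ℕ) → ℝ) (η L : ℝ) : Prop where
  eta_pos : 0 < η
  L_nonneg : 0 ≤ L
  nonneg : ∀ q, 0 ≤ Ψ q
  map_zero : Ψ 0 = 0
  sum_le : ∀ q, ∑ i, (q i : ℝ) ≤ L * Ψ q
  le_sum : ∀ q, Ψ q ≤ L * (1 + ∑ i, (q i : ℝ))
  abs_sub_le : ∀ q s m a, (∀ i, s i ≤ 1) → IsLongestConnected q s m →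
    |Ψ (q - m + a) - Ψ q| ≤ L * (1 + ∑ i, (a i : ℝ))
  integral_le : ∀ t q s m, (∀ i, s i ≤ 1) → IsLongestConnected q s m → q ≠ 0 →
    ∫ ω, Ψ (q - m + X.arr t ω) ∂P ≤ g q s
  drift : ∀ t q, q ≠ 0 → ∫ ω, g q (X.chan t ω) ∂P ≤ Ψ q - η

theorem exists_isDriftFunction [IsProbabilityMeasure P] (X : OnOffSystem P p lam) {z r ε : ℝ}
    (h0 : 0 ≤ z) (h1 : z ≤ 1) (hε : 0 < ε)
    (hlam : ∀ i, z * lam i + (1 - z) * ∑ j, lam j + ε ≤ r)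
    (hr : ∀ t q, (∑ i, (q i : ℝ)) * r ≤ ∫ ω, servedWeight z q (X.chan t ω) ∂P)
    (hload : ∑ i, lam i < 1) (hp : 0 < pMin p) :
    ∃ Ψ g η L, X.IsDriftFunction Ψ g η L := by
  set C : ℝ := 1 / 2 * (∫ ω, (∑ i, (X.arr 0 ω i : ℝ)) ^ 2 ∂P + 1) with hC
  have hC0 : 0 ≤ C := by
    have : 0 ≤ ∫ ω, (∑ i, (X.arr 0 ω i : ℝ)) ^ 2 ∂P := integral_nonneg fun ω => sq_nonneg _
    rw [hC]; linarith
  obtain ⟨n₀, hn₀⟩ := exists_nat_ge ((2 * C / ε) ^ 2)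
  -- Half of a lower bound for the probability of one transmission and no arrival in a slot with
  -- nonempty queues.
  set θ : ℝ := (1 - ∑ i, lam i) * pMin p / 2 with hθ
  have hl0 : 0 ≤ ∑ i, lam i := Finset.sum_nonneg fun i _ => X.lam_nonneg i
  have hθ0 : 0 < θ := div_pos (mul_pos (by linarith) hp) (by norm_num)
  have hθ1 : θ ≤ 1 := by
    have := mul_le_one₀ (by linarith : 1 - ∑ i, lam i ≤ 1) hp.le X.pMin_le_one
    rw [hθ]; linarith
  have hΓ : 0 ≤ C / θ ^ n₀ := by positivity
  set Γ := C / θ ^ n₀ with hΓdef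
  have hN : (0 : ℝ) ≤ N := Nat.cast_nonneg N
  refine ⟨linLyap z Γ θ, linLyapStep lam z Γ θ C, ε / 2, N + 1 + Γ, by linarith, by linarith,
    fun q => (gramNorm_nonneg _ _).trans (gramNorm_le_linLyap hΓ hθ0.le hθ1 q), linLyap_zero,
    fun q => ?_, fun q => ?_, fun q s m a hs h => ?_, fun t q s m hs h hq => ?_,
    fun t q hq => ?_⟩
  · refine (sum_le_mul_gramNorm h1 (castVec_nonneg q)).trans ?_
    refine mul_le_mul (by linarith) (gramNorm_le_linLyap hΓ hθ0.le hθ1 q)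
      (gramNorm_nonneg _ _) (by linarith)
  · have : 0 ≤ ∑ i, (q i : ℝ) := by positivity
    refine (linLyap_le h0 hΓ hθ0.le q).trans ?_
    nlinarith [mul_nonneg hN this, mul_nonneg hΓ this]
  · have : 0 ≤ ∑ i, (a i : ℝ) := by positivity
    refine (abs_linLyap_sub_le h0 h1 hΓ hθ0.le hθ1 hs h a).trans ?_
    gcongr
    linarith
  · exact X.integral_linLyap_step_le t h0 h1 hΓ hθ0.le hθ1 hload.le hs h hq
  · exact X.integral_linLyapStep_le t h0 h1 hε hlam hr hC0 hn₀ hθ0 hθ1 (by rw [hθ]; linarith)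
      hload.le hΓdef hq

section Tail

variable {X : OnOffSystem P p lam} {Ψ : (Fin N → ℕ) → ℝ} {g : (Fin N → ℕ) → (Fin N → ℕ) → ℝ}
  {η L : ℝ}

theorem IsDriftFunction.sq_le (h : X.IsDriftFunction Ψ g η L) (q : Fin N → ℕ) :
    Ψ q ^ 2 ≤ L ^ 2 * (1 + ∑ i, (q i : ℝ)) ^ 2 := by
  rw [← mul_pow]
  exact pow_le_pow_left₀ (h.nonneg q) (h.le_sum q) 2

theorem IsDriftFunction.integrable [IsProbabilityMeasure P] (h : X.IsDriftFunction Ψ g η L) (t : ℕ)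
    (x : Fin N → ℕ) : Integrable (fun ω => Ψ (x + X.arr t ω)) P := by
  refine X.integrable_of_le_linear t h.nonneg h.L_nonneg (fun x => (h.le_sum x).trans ?_) x
  have : 0 ≤ ∑ i, (x i : ℝ) := by positivity
  exact mul_le_mul_of_nonneg_left (by nlinarith) h.L_nonneg

theorem integrable_one_add_sum_arr_sq [IsProbabilityMeasure P] (X : OnOffSystem P p lam) (t : ℕ)
    (L : ℝ) : Integrable (fun ω => (L * (1 + ∑ i, (X.arr t ω i : ℝ))) ^ 2) P := by
  refine X.integrable_arr t (f := fun a => (L * (1 + ∑ i, (a i : ℝ))) ^ 2) (k := 2 * L ^ 2)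
    fun a => ?_
  rw [abs_of_nonneg (sq_nonneg _)]
  nlinarith [sq_nonneg (L * (1 - ∑ i, (a i : ℝ)))]

/-- Truncated second moment of the arrivals. -/
noncomputable def arrTail (X : OnOffSystem P p lam) (L M : ℝ) : ℝ :=
  ∫ ω, (if M / 2 < L * (1 + ∑ i, (X.arr 0 ω i : ℝ)) then
    (L * (1 + ∑ i, (X.arr 0 ω i : ℝ))) ^ 2 else 0) ∂P

theorem tendsto_arrTail [IsProbabilityMeasure P] (X : OnOffSystem P p lam) (L : ℝ) :
    Tendsto (fun n : ℕ => X.arrTail L n) atTop (𝓝 0) := by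
  have : ∫ _ : Ω, (0 : ℝ) ∂P = 0 := by simp
  rw [← this]
  refine tendsto_integral_of_dominated_convergence
    (fun ω => (L * (1 + ∑ i, (X.arr 0 ω i : ℝ))) ^ 2) (fun n => ?_)
    (X.integrable_one_add_sum_arr_sq 0 L) (fun n => ae_of_all _ fun ω => ?_)
    (ae_of_all _ fun ω => ?_)
  · exact ((measurable_of_countable fun a : Fin N → ℕ =>
      (if (n : ℝ) / 2 < L * (1 + ∑ i, (a i : ℝ)) then
        (L * (1 + ∑ i, (a i : ℝ))) ^ 2 else 0)).comp (X.measurable_arr 0)).aestronglyMeasurable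
  · split_ifs
    · rw [Real.norm_eq_abs, abs_of_nonneg (sq_nonneg _)]
    · simpa using sq_nonneg (L * (1 + ∑ i, (X.arr 0 ω i : ℝ)))
  · obtain ⟨n₀, hn₀⟩ := exists_nat_ge (2 * (L * (1 + ∑ i, (X.arr 0 ω i : ℝ))))
    refine tendsto_const_nhds.congr' ?_
    filter_upwards [eventually_ge_atTop n₀] with n hn
    have : (n₀ : ℝ) ≤ n := by exact_mod_cast hn
    rw [if_neg (by linarith)]

/-- The first-order term has nonpositive mean: it vanishes at the empty state because Ψ(0) = 0 < M,
and elsewhere the drift is negative. The second-order error is split by `sq_posPart_sub_le`; the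
indicator of Ψ > M/2 is replaced by (2L/M)(1 + ∑ q_i) as in Markov's inequality, and large
increments go into `arrTail`. -/
theorem IsDriftFunction.lintegral_truncated_step_le [IsProbabilityMeasure P]
    (h : X.IsDriftFunction Ψ g η L) (hX : X.IsLCQ) (hN : 0 < N) {M : ℝ} (hM : 0 < M) (t : ℕ) :
    ∫⁻ ω, ENNReal.ofReal ((max (Ψ (X.queue (t + 1) ω) - M) 0) ^ 2) ∂P ≤
      ∫⁻ ω, ENNReal.ofReal ((max (Ψ (X.queue t ω) - M) 0) ^ 2) ∂P +
      ENNReal.ofReal ((∫ ω, (L * (1 + ∑ i, (X.arr 0 ω i : ℝ))) ^ 2 ∂P) * (2 * L / M)) *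
        (1 + ∫⁻ ω, ∑ i, (X.queue t ω i : ℝ≥0∞) ∂P) + ENNReal.ofReal (X.arrTail L M) := by
  set κ := ∫ ω, (L * (1 + ∑ i, (X.arr 0 ω i : ℝ))) ^ 2 ∂P with hκ
  have hκ0 : 0 ≤ κ := integral_nonneg fun ω => sq_nonneg _
  have hL := h.L_nonneg
  have hk0 : 0 ≤ κ * (2 * L / M) := by positivity
  set F : (Fin N → ℕ) → ℝ := fun q => (max (Ψ q - M) 0) ^ 2 with hF
  have hFint : ∀ x, Integrable (fun ω => F (x + X.arr t ω)) P := fun x => by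
    refine X.integrable_of_le_linear t (F := F) (fun x => sq_nonneg _) (sq_nonneg L)
      (fun x => le_trans ?_ (h.sq_le x)) x
    exact pow_le_pow_left₀ (le_max_right _ _) (max_le (by linarith) (h.nonneg x)) 2
  have hstep := X.lintegral_step_le hX hN t F (fun x => sq_nonneg _) hFint
    (fun q s => F q + 2 * max (Ψ q - M) 0 * (g q s - Ψ q) + κ * (2 * L / M) *
      (1 + ∑ i, (q i : ℝ)) + X.arrTail L M)
    (fun q => F q + κ * (2 * L / M) * (1 + ∑ i, (q i : ℝ)) + X.arrTail L M) (fun _ => 0)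
    (fun _ => le_rfl)
    (fun q s m hs hm => by
      have i1 : Integrable (fun ω =>
          2 * max (Ψ q - M) 0 * (Ψ (q - m + X.arr t ω) - Ψ q)) P :=
        ((h.integrable t (q - m)).sub (integrable_const (Ψ q))).const_mul _
      have i2 := (X.integrable_one_add_sum_arr_sq t L).mul_const (if M / 2 < Ψ q then (1 : ℝ) else 0)
      have i3 : Integrable (fun ω => (if M / 2 < L * (1 + ∑ i, (X.arr t ω i : ℝ)) then
          (L * (1 + ∑ i, (X.arr t ω i : ℝ))) ^ 2 else 0)) P := by
        refine X.integrable_arr t (f := fun a => if M / 2 < L * (1 + ∑ i, (a i : ℝ)) then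
          (L * (1 + ∑ i, (a i : ℝ))) ^ 2 else 0) (k := 2 * L ^ 2) fun a => ?_
        split_ifs
        · rw [abs_of_nonneg (sq_nonneg _)]
          nlinarith [sq_nonneg (L * (1 - ∑ i, (a i : ℝ)))]
        · simp; positivity
      have i0 : Integrable (fun _ : Ω => F q) P := integrable_const _
      have i4 : Integrable (fun ω => F q +
        2 * max (Ψ q - M) 0 * (Ψ (q - m + X.arr t ω) - Ψ q)) P := i0.add i1
      have i5 : Integrable (fun ω => F q +
        2 * max (Ψ q - M) 0 * (Ψ (q - m + X.arr t ω) - Ψ q) +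
        (L * (1 + ∑ i, (X.arr t ω i : ℝ))) ^ 2 * (if M / 2 < Ψ q then (1 : ℝ) else 0)) P :=
        i4.add i2
      refine (integral_mono (hFint _) (i5.add i3) fun ω =>
        sq_posPart_sub_le hM.le (h.abs_sub_le q s m (X.arr t ω) hs hm)).trans ?_
      simp only [Pi.add_apply]
      rw [integral_add i5 i3, integral_add i4 i2, integral_add i0 i1, integral_const_mul,
        integral_sub (h.integrable t _) (integrable_const _), integral_mul_const,
        X.integral_arr t fun a => (L * (1 + ∑ i, (a i : ℝ))) ^ 2, ← hκ,
        X.integral_arr t fun a => if M / 2 < L * (1 + ∑ i, (a i : ℝ)) then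
          (L * (1 + ∑ i, (a i : ℝ))) ^ 2 else 0]
      simp only [integral_const, probReal_univ, one_smul]
      have e1 : max (Ψ q - M) 0 * ((∫ ω, Ψ (q - m + X.arr t ω) ∂P) - Ψ q) ≤
          max (Ψ q - M) 0 * (g q s - Ψ q) := by
        by_cases hq : q = 0
        · have : max (Ψ q - M) 0 = 0 := by
            rw [hq, h.map_zero]; exact max_eq_right (by linarith)
          rw [this]; simp
        · exact mul_le_mul_of_nonneg_left
            (by linarith [h.integral_le t q s m hs hm hq]) (le_max_right _ _)
      have e2 : κ * (if M / 2 < Ψ q then (1 : ℝ) else 0) ≤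
          κ * (2 * L / M) * (1 + ∑ i, (q i : ℝ)) := by
        rw [mul_assoc]
        refine mul_le_mul_of_nonneg_left ?_ hκ0
        split_ifs with hc
        · have := h.le_sum q
          rw [div_mul_eq_mul_div, le_div_iff₀ hM]
          linarith
        · positivity
      unfold arrTail
      linarith)
    (fun q => by
      have i1 := X.integrable_chan t fun s => 2 * max (Ψ q - M) 0 * g q s
      have e : ∀ ω, F q + 2 * max (Ψ q - M) 0 * (g q (X.chan t ω) - Ψ q) +
          κ * (2 * L / M) * (1 + ∑ i, (q i : ℝ)) + X.arrTail L M =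
          (F q - 2 * max (Ψ q - M) 0 * Ψ q + κ * (2 * L / M) * (1 + ∑ i, (q i : ℝ)) +
            X.arrTail L M) + 2 * max (Ψ q - M) 0 * g q (X.chan t ω) := fun ω => by ring
      simp only [e]
      rw [integral_add (integrable_const _) i1, integral_const_mul]
      simp only [integral_const, probReal_univ, one_smul]
      have e1 : max (Ψ q - M) 0 * (∫ ω, g q (X.chan t ω) ∂P) ≤ max (Ψ q - M) 0 * Ψ q := by
        by_cases hq : q = 0
        · have : max (Ψ q - M) 0 = 0 := by
            rw [hq, h.map_zero]; exact max_eq_right (by linarith)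
          rw [this]; simp
        · exact mul_le_mul_of_nonneg_left
            (by linarith [h.drift t q hq, h.eta_pos]) (le_max_right _ _)
      linarith)
    (fun _ => 1) (fun _ _ _ => rfl)
  simp only [one_mul] at hstep
  refine (le_self_add.trans hstep).trans ?_
  have hm : Measurable fun ω => ∑ i, (X.queue t ω i : ℝ≥0∞) :=
    (measurable_of_countable fun q : Fin N → ℕ => ∑ i, (q i : ℝ≥0∞)).comp (X.measurable_queue t)
  have hm2 : Measurable fun ω => ENNReal.ofReal (F (X.queue t ω)) :=
    (measurable_of_countable fun q => ENNReal.ofReal (F q)).comp (X.measurable_queue t)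
  calc _ ≤ ∫⁻ ω, (ENNReal.ofReal (F (X.queue t ω)) + ENNReal.ofReal (κ * (2 * L / M)) *
        (1 + ∑ i, (X.queue t ω i : ℝ≥0∞)) + ENNReal.ofReal (X.arrTail L M)) ∂P := by
        refine lintegral_mono fun ω => ?_
        refine ENNReal.ofReal_add_le.trans (add_le_add_left (ENNReal.ofReal_add_le.trans
          (add_le_add_right (le_of_eq ?_) _)) _)
        rw [ENNReal.ofReal_mul hk0, ENNReal.ofReal_add zero_le_one (by positivity),
          ENNReal.ofReal_sum_of_nonneg fun i _ => Nat.cast_nonneg _]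
        simp
    _ = _ := by
        have hm1 : Measurable fun ω => 1 + ∑ i, (X.queue t ω i : ℝ≥0∞) := measurable_const.add hm
        rw [lintegral_add_right _ measurable_const, lintegral_add_left hm2,
          lintegral_const_mul _ hm1, lintegral_add_left measurable_const]
        simp only [lintegral_const, measure_univ, mul_one, hF]

/-- The second moments of the backlogs grow slower than linearly. -/
theorem IsDriftFunction.tendsto_sq_div [IsProbabilityMeasure P]
    (h : X.IsDriftFunction Ψ g η L) (hX : X.IsLCQ) (hN : 0 < N) {a b : ℝ≥0∞} (ha : a ≠ ∞)
    (hb : b ≠ ∞) (hab : ∀ t : ℕ, ∑ τ ∈ Finset.range t,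
      ∫⁻ ω, ∑ i, (X.queue τ ω i : ℝ≥0∞) ∂P ≤ a + t * b) :
    Tendsto (fun t : ℕ => (∫⁻ ω, ENNReal.ofReal (Ψ (X.queue t ω) ^ 2) ∂P) / (t : ℝ≥0∞)) atTop
      (𝓝 0) := by
  set κ := ∫ ω, (L * (1 + ∑ i, (X.arr 0 ω i : ℝ))) ^ 2 ∂P with hκ
  have hκ0 : 0 ≤ κ := integral_nonneg fun ω => sq_nonneg _
  -- The truncation level M = n + 1 is fixed while t → ∞. The resulting bound on the growth rate
  -- tends to 0 as M → ∞, because the average backlog is bounded and the arrivals are square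
  -- integrable.
  have hbound : ∀ n : ℕ, limsup (fun t : ℕ => (∫⁻ ω, ENNReal.ofReal (Ψ (X.queue t ω) ^ 2) ∂P) /
      (t : ℝ≥0∞)) atTop ≤ 2 * (ENNReal.ofReal (κ * (2 * L / ((n + 1 : ℕ) : ℝ))) * (1 + b) +
        ENNReal.ofReal (X.arrTail L ((n + 1 : ℕ) : ℝ))) := by
    intro n
    have hM : (0 : ℝ) < ((n + 1 : ℕ) : ℝ) := by positivity
    generalize ((n + 1 : ℕ) : ℝ) = M at *
    have hstep : ∀ t, (∫⁻ ω, ENNReal.ofReal ((max (Ψ (X.queue (t + 1) ω) - M) 0) ^ 2) ∂P) + 0 ≤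
        (∫⁻ ω, ENNReal.ofReal ((max (Ψ (X.queue t ω) - M) 0) ^ 2) ∂P) +
        (ENNReal.ofReal (κ * (2 * L / M)) * (1 + ∫⁻ ω, ∑ i, (X.queue t ω i : ℝ≥0∞) ∂P) +
          ENNReal.ofReal (X.arrTail L M)) := fun t => by
      rw [add_zero, ← add_assoc]
      exact h.lintegral_truncated_step_le hX hN hM t
    have hsum := add_sum_range_le_of_step hstep
    set k := ENNReal.ofReal (κ * (2 * L / M))
    set e := ENNReal.ofReal (X.arrTail L M)
    set f0 := ∫⁻ ω, ENNReal.ofReal ((max (Ψ (X.queue 0 ω) - M) 0) ^ 2) ∂P with hf0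
    have hf0t : f0 ≠ ∞ := by
      refine X.lintegral_init_lt_top (f := fun q => (max (Ψ q - M) 0) ^ 2) (k := 2 * L ^ 2)
        fun q => ?_
      have e1 : (max (Ψ q - M) 0) ^ 2 ≤ Ψ q ^ 2 :=
        pow_le_pow_left₀ (le_max_right _ _) (max_le (by linarith) (h.nonneg q)) 2
      have e2 := h.sq_le q
      nlinarith [sq_nonneg (L * (1 - ∑ i, (q i : ℝ)))]
    refine limsup_div_natCast_le
      (e := fun _ => 2 * (f0 + k * a) + ENNReal.ofReal (2 * M ^ 2)) (fun t => ?_)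
      (tendsto_const_div_natCast ?_)
    · have e1 : ∫⁻ ω, ENNReal.ofReal (Ψ (X.queue t ω) ^ 2) ∂P ≤
          2 * (∫⁻ ω, ENNReal.ofReal ((max (Ψ (X.queue t ω) - M) 0) ^ 2) ∂P) +
            ENNReal.ofReal (2 * M ^ 2) := by
        calc _ ≤ ∫⁻ ω, (2 * ENNReal.ofReal ((max (Ψ (X.queue t ω) - M) 0) ^ 2) +
              ENNReal.ofReal (2 * M ^ 2)) ∂P := by
              refine lintegral_mono fun ω => ?_
              have : Ψ (X.queue t ω) ^ 2 ≤
                  2 * (max (Ψ (X.queue t ω) - M) 0) ^ 2 + 2 * M ^ 2 := by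
                have k1 := le_max_left (Ψ (X.queue t ω) - M) 0
                have k2 := le_max_right (Ψ (X.queue t ω) - M) 0
                have k3 := h.nonneg (X.queue t ω)
                nlinarith [sq_nonneg (max (Ψ (X.queue t ω) - M) 0 - M)]
              refine (ENNReal.ofReal_le_ofReal this).trans (ENNReal.ofReal_add_le.trans ?_)
              rw [ENNReal.ofReal_mul (by norm_num : (0 : ℝ) ≤ 2)]
              simp
          _ = _ := by
              have hm : Measurable fun ω =>
                  ENNReal.ofReal ((max (Ψ (X.queue t ω) - M) 0) ^ 2) :=
                (measurable_of_countable fun q => ENNReal.ofReal ((max (Ψ q - M) 0) ^ 2)).comp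
                  (X.measurable_queue t)
              rw [lintegral_add_right _ measurable_const, lintegral_const_mul _ hm]
              simp
      refine e1.trans ?_
      have e2 := le_self_add.trans (hsum t)
      rw [Finset.sum_add_distrib, ← Finset.mul_sum, Finset.sum_add_distrib] at e2
      simp only [Finset.sum_const, Finset.card_range, nsmul_eq_mul, mul_one] at e2
      calc _ ≤ 2 * (f0 + (k * (t + (a + t * b)) + t * e)) + ENNReal.ofReal (2 * M ^ 2) := by
            gcongr
            refine e2.trans ?_
            gcongr
            exact hab t
        _ = _ := by ring
    · exact ENNReal.add_ne_top.2 ⟨ENNReal.mul_ne_top (by simp) (ENNReal.add_ne_top.2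
        ⟨hf0t, ENNReal.mul_ne_top ENNReal.ofReal_ne_top ha⟩), ENNReal.ofReal_ne_top⟩
  have hlim : Tendsto (fun n : ℕ => 2 * (ENNReal.ofReal (κ * (2 * L / ((n + 1 : ℕ) : ℝ))) *
      (1 + b) + ENNReal.ofReal (X.arrTail L ((n + 1 : ℕ) : ℝ)))) atTop (𝓝 0) := by
    have l1 : Tendsto (fun n : ℕ => ENNReal.ofReal (κ * (2 * L / ((n + 1 : ℕ) : ℝ)))) atTop
        (𝓝 0) := by
      have := ((tendsto_const_div_atTop_nhds_zero_nat (2 * L)).comp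
        (tendsto_add_atTop_nat 1)).const_mul κ
      rw [mul_zero] at this
      simpa using ENNReal.tendsto_ofReal this
    have l2 : Tendsto (fun n : ℕ => ENNReal.ofReal (X.arrTail L ((n + 1 : ℕ) : ℝ))) atTop
        (𝓝 0) := by
      simpa using ENNReal.tendsto_ofReal ((X.tendsto_arrTail L).comp (tendsto_add_atTop_nat 1))
    have l3 := ENNReal.Tendsto.mul_const l1
      (Or.inr (ENNReal.add_ne_top.2 ⟨ENNReal.one_ne_top, hb⟩) : (0 : ℝ≥0∞) ≠ 0 ∨ 1 + b ≠ ∞)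
    have l4 := ENNReal.Tendsto.const_mul (l3.add l2)
      (Or.inr (by simp) : (0 * (1 + b) + 0 : ℝ≥0∞) ≠ 0 ∨ (2 : ℝ≥0∞) ≠ ∞)
    simpa using l4
  have hls := ge_of_tendsto' hlim hbound
  exact tendsto_of_le_liminf_of_limsup_le bot_le hls

end Tail

end OnOffSystem

/-! ### From backlogs to delays -/

/-- The lower integral is superadditive without measurability, so the delays, which are infinite
sums, need not be shown to be measurable. -/
theorem sum_lintegral_le_lintegral_sum {Ω ι : Type*} [MeasurableSpace Ω] {P : Measure Ω}
    (s : Finset ι) (f : ι → Ω → ℝ≥0∞) :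
    ∑ i ∈ s, ∫⁻ ω, f i ω ∂P ≤ ∫⁻ ω, ∑ i ∈ s, f i ω ∂P := by
  classical
  induction s using Finset.induction_on with
  | empty => simp
  | insert i s hi ih =>
    simp only [Finset.sum_insert hi]
    exact (add_le_add_right ih _).trans (le_lintegral_add _ _)

theorem sum_range_sum_Ico {M : Type*} [AddCommMonoid M] {e : ℕ → ℕ} (he : Monotone e) (f : ℕ → M)
    (t : ℕ) : ∑ s ∈ Finset.range t, ∑ n ∈ Finset.Ico (e s) (e (s + 1)), f n =
      ∑ n ∈ Finset.Ico (e 0) (e t), f n := by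
  induction t with
  | zero => simp
  | succ t ih =>
    rw [Finset.sum_range_succ, ih,
      Finset.sum_Ico_consecutive _ (he (Nat.zero_le t)) (he (Nat.le_succ t))]

namespace OnOffSystem

variable {Ω : Type*} [MeasurableSpace Ω] {P : Measure Ω} {N : ℕ} {p lam : Fin N → ℝ}

theorem entered_mono (X : OnOffSystem P p lam) (ω : Ω) (i : Fin N) :
    Monotone fun t => X.entered t ω i := fun _ _ h =>
  Nat.add_le_add_left (Finset.sum_le_sum_of_subset (Finset.range_mono h)) _

theorem departed_mono (X : OnOffSystem P p lam) (ω : Ω) (i : Fin N) :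
    Monotone fun t => X.departed t ω i := fun _ _ h =>
  Finset.sum_le_sum_of_subset (Finset.range_mono h)

/-- Number of packets that entered before slot `t` and have not been transmitted before
slot `τ`. -/
def residual (X : OnOffSystem P p lam) (t τ : ℕ) (ω : Ω) : ℕ :=
  ∑ i, (X.entered t ω i - X.departed τ ω i)

theorem residual_factorsThrough (X : OnOffSystem P p lam) {t τ : ℕ} (h : t ≤ τ) :
    Function.FactorsThrough (X.residual t τ) (X.hist τ) := fun ω ω' hω => by
  unfold residual
  rw [X.entered_factorsThrough h hω, X.departed_factorsThrough τ hω]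

theorem residual_self (X : OnOffSystem P p lam) (t : ℕ) (ω : Ω) :
    X.residual t t ω = ∑ i, X.queue t ω i :=
  Finset.sum_congr rfl fun i _ => by have := X.queue_add_departed t ω i; omega

theorem residual_le (X : OnOffSystem P p lam) {t τ : ℕ} (h : t ≤ τ) (ω : Ω) :
    X.residual t τ ω ≤ ∑ i, X.queue τ ω i :=
  Finset.sum_le_sum fun i _ => by
    have h1 := X.queue_add_departed τ ω i
    have h2 := X.entered_mono ω i h
    simp only at h2
    omega

theorem residual_succ_le (X : OnOffSystem P p lam) (t τ : ℕ) (ω : Ω) :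
    X.residual t (τ + 1) ω ≤ X.residual t τ ω :=
  Finset.sum_le_sum fun i _ => Nat.sub_le_sub_left (X.departed_mono ω i (Nat.le_succ τ)) _

/-- The sojourn of the packets that entered before slot `t` from slot `t` on. -/
theorem IsDriftFunction.tsum_residual_le [IsProbabilityMeasure P] {X : OnOffSystem P p lam}
    {Ψ : (Fin N → ℕ) → ℝ} {g : (Fin N → ℕ) → (Fin N → ℕ) → ℝ} {η L : ℝ}
    (h : X.IsDriftFunction Ψ g η L) (hX : X.IsLCQ) (hN : 0 < N) (t : ℕ) :
    ∑' k, ∫⁻ ω, (X.residual t (t + k) ω : ℝ≥0∞) ∂P ≤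
      ENNReal.ofReal (L / η) * ∫⁻ ω, ENNReal.ofReal (Ψ (X.queue t ω) ^ 2) ∂P := by
  have hη := h.eta_pos
  have hL := h.L_nonneg
  have hzero : ∀ {τ ω}, t ≤ τ → X.queue τ ω = 0 → X.residual t τ ω = 0 := fun {τ ω} hτ hq => by
    have := X.residual_le hτ ω
    simpa [hq] using this
  have hl0 : 0 ≤ ∑ i, lam i := Finset.sum_nonneg fun i _ => X.lam_nonneg i
  -- R Ψ(Q) is a supermartingale with a gain: R cannot increase, and R is known from the history, so
  -- Ψ loses η on average with weight R.
  have hstep : ∀ k, (∫⁻ ω, (X.residual t (t + (k + 1)) ω : ℝ≥0∞) *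
      ENNReal.ofReal (Ψ (X.queue (t + (k + 1)) ω)) ∂P) +
      ENNReal.ofReal η * ∫⁻ ω, (X.residual t (t + k) ω : ℝ≥0∞) ∂P ≤
      (∫⁻ ω, (X.residual t (t + k) ω : ℝ≥0∞) *
        ENNReal.ofReal (Ψ (X.queue (t + k) ω)) ∂P) + 0 := by
    intro k
    have htk : t ≤ t + k := Nat.le_add_right t k
    have hres := X.residual_factorsThrough htk
    have hs := X.lintegral_step_le hX hN (t + k) Ψ h.nonneg (h.integrable (t + k))
      -- At the empty state Ψ may grow, but R = 0 there; any finite bound on its next mean serves,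
      -- and the weight erases it.
      (fun q s => if q = 0 then L * (1 + ∑ i, lam i) else g q s)
      (fun q => if q = 0 then L * (1 + ∑ i, lam i) else Ψ q)
      (fun q => if q = 0 then 0 else η)
      (fun q => by split_ifs; exacts [le_rfl, hη.le])
      (fun q s m hs hm => by
        by_cases hq : q = 0
        · simp only [hq, if_true]
          have i1 : Integrable (fun ω => L * (1 + ∑ i, (X.arr (t + k) ω i : ℝ))) P :=
            ((integrable_const (1 : ℝ)).add
              (integrable_finsetSum _ fun i _ => X.integrable_arr_apply (t + k) i)).const_mul L
          refine (integral_mono (h.integrable (t + k) _) i1 fun ω => ?_).trans (le_of_eq ?_)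
          · have := h.abs_sub_le q s m (X.arr (t + k) ω) hs hm
            rw [hq, h.map_zero, sub_zero] at this
            exact (le_abs_self _).trans this
          · rw [integral_const_mul, integral_add (integrable_const _)
              (integrable_finsetSum _ fun i _ => X.integrable_arr_apply (t + k) i),
              X.integral_sum_arr]
            simp
        · simp only [hq, if_false]
          exact h.integral_le (t + k) q s m hs hm hq)
      (fun q => by
        by_cases hq : q = 0
        · simp [hq]
        · simp only [hq, if_false]
          exact h.drift (t + k) q hq)
      (fun ω => (X.residual t (t + k) ω : ℝ≥0∞)) (fun ω ω' hω => by
        simp only [hres hω])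
    have hm : Measurable fun ω => (X.residual t (t + k) ω : ℝ≥0∞) :=
      (measurable_of_countable fun n : ℕ => (n : ℝ≥0∞)).comp (X.measurable_of_factorsThrough hres)
    have e1 : ∫⁻ ω, (X.residual t (t + k) ω : ℝ≥0∞) *
        ENNReal.ofReal (if X.queue (t + k) ω = 0 then 0 else η) ∂P =
        ENNReal.ofReal η * ∫⁻ ω, (X.residual t (t + k) ω : ℝ≥0∞) ∂P := by
      rw [← lintegral_const_mul _ hm]
      refine lintegral_congr fun ω => ?_
      split_ifs with hq
      · simp [hzero htk hq]
      · exact mul_comm _ _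
    have e2 : ∫⁻ ω, (X.residual t (t + k) ω : ℝ≥0∞) *
        ENNReal.ofReal (if X.queue (t + k) ω = 0 then L * (1 + ∑ i, lam i)
          else Ψ (X.queue (t + k) ω)) ∂P =
        ∫⁻ ω, (X.residual t (t + k) ω : ℝ≥0∞) * ENNReal.ofReal (Ψ (X.queue (t + k) ω)) ∂P := by
      refine lintegral_congr fun ω => ?_
      split_ifs with hq
      · simp [hzero htk hq]
      · rfl
    rw [e1, e2] at hs
    rw [add_zero]
    refine le_trans (add_le_add_left (lintegral_mono fun ω => ?_) _) hs
    exact mul_le_mul' (Nat.cast_le.2 (X.residual_succ_le t (t + k) ω)) le_rfl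
  have hη' : ENNReal.ofReal η ≠ 0 := by simpa using hη
  refine ENNReal.tsum_le_of_sum_range_le fun n => ?_
  have hsum := le_add_self.trans (add_sum_range_le_of_step hstep n)
  rw [← Finset.mul_sum, Finset.sum_const_zero, add_zero] at hsum
  -- At slot t every packet present is an old one, so R = ∑ Q_i ≤ L Ψ and the initial product is at
  -- most L Ψ².
  have hinit : ∫⁻ ω, (X.residual t (t + 0) ω : ℝ≥0∞) *
      ENNReal.ofReal (Ψ (X.queue (t + 0) ω)) ∂P ≤
      ENNReal.ofReal L * ∫⁻ ω, ENNReal.ofReal (Ψ (X.queue t ω) ^ 2) ∂P := by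
    have hm : Measurable fun ω => ENNReal.ofReal (Ψ (X.queue t ω) ^ 2) :=
      (measurable_of_countable fun q => ENNReal.ofReal (Ψ q ^ 2)).comp (X.measurable_queue t)
    rw [← lintegral_const_mul _ hm]
    refine lintegral_mono fun ω => ?_
    rw [add_zero, X.residual_self, ← ENNReal.ofReal_natCast,
      ← ENNReal.ofReal_mul (Nat.cast_nonneg _), ← ENNReal.ofReal_mul hL]
    refine ENNReal.ofReal_le_ofReal ?_
    have h1 := mul_le_mul_of_nonneg_right (h.sum_le (X.queue t ω)) (h.nonneg (X.queue t ω))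
    push_cast
    linarith
  have h3 := hsum.trans hinit
  rw [ENNReal.ofReal_div_of_pos hη, ENNReal.mul_comm_div, ← mul_div_assoc,
    ENNReal.le_div_iff_mul_le (Or.inl hη') (Or.inl ENNReal.ofReal_ne_top), mul_comm]
  exact h3

/-- The delays of the packets that arrive before slot `t`, sorted by slots. -/
theorem sum_delay_le (X : OnOffSystem P p lam) (t : ℕ) (ω : Ω) :
    ∑ s ∈ Finset.range t, ∑ i, ∑ n ∈ Finset.Ico (X.entered s ω i) (X.entered (s + 1) ω i),
      X.delay i n ω ≤ ∑' τ : ℕ, if τ < t then ((∑ i, X.queue τ ω i : ℕ) : ℝ≥0∞)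
        else (X.residual t τ ω : ℝ≥0∞) := by
  rw [Finset.sum_comm, Finset.sum_congr rfl fun i _ =>
    sum_range_sum_Ico (X.entered_mono ω i) (fun n => X.delay i n ω) t]
  simp only [delay]
  calc _ = ∑ i, ∑' τ : ℕ, ∑ n ∈ Finset.Ico (X.entered 0 ω i) (X.entered t ω i),
        (if X.departed τ ω i ≤ n ∧ n < X.entered τ ω i then (1 : ℝ≥0∞) else 0) :=
        Finset.sum_congr rfl fun i _ => (Summable.tsum_finsetSum fun _ _ => ENNReal.summable).symm
    _ = ∑' τ : ℕ, ∑ i, ∑ n ∈ Finset.Ico (X.entered 0 ω i) (X.entered t ω i),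
        (if X.departed τ ω i ≤ n ∧ n < X.entered τ ω i then (1 : ℝ≥0∞) else 0) :=
        (Summable.tsum_finsetSum fun _ _ => ENNReal.summable).symm
    _ ≤ _ := by
        refine ENNReal.tsum_le_tsum fun τ => ?_
        -- The packets waiting at slot τ have consecutive numbers from `departed` at τ up to
        -- `entered` at τ; those that entered before slot t are cut off at `entered` at t.
        have hcount : ∀ i, ∑ n ∈ Finset.Ico (X.entered 0 ω i) (X.entered t ω i),
            (if X.departed τ ω i ≤ n ∧ n < X.entered τ ω i then (1 : ℝ≥0∞) else 0) ≤
            ((min (X.entered t ω i) (X.entered τ ω i) - X.departed τ ω i : ℕ) : ℝ≥0∞) := by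
          intro i
          rw [Finset.sum_boole, ← Nat.card_Ico]
          refine Nat.cast_le.2 (Finset.card_le_card fun n hn => ?_)
          simp only [Finset.mem_filter, Finset.mem_Ico] at hn ⊢
          omega
        refine (Finset.sum_le_sum fun i _ => hcount i).trans ?_
        split_ifs with hτ
        · rw [Nat.cast_sum]
          refine Finset.sum_le_sum fun i _ => Nat.cast_le.2 ?_
          have := X.queue_add_departed τ ω i
          omega
        · rw [residual, Nat.cast_sum]
          refine Finset.sum_le_sum fun i _ => ?_
          exact Nat.cast_le.2 (Nat.sub_le_sub_right (min_le_left _ _) _)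

theorem sum_lintegral_delay_le (X : OnOffSystem P p lam) (t : ℕ) :
    ∑ s ∈ Finset.range t, ∑ i, ∫⁻ ω,
      ∑ n ∈ Finset.Ico (X.entered s ω i) (X.entered (s + 1) ω i), X.delay i n ω ∂P ≤
    (∑ τ ∈ Finset.range t, ∫⁻ ω, ∑ i, (X.queue τ ω i : ℝ≥0∞) ∂P) +
      ∑' k, ∫⁻ ω, (X.residual t (t + k) ω : ℝ≥0∞) ∂P := by
  let B : ℕ → Ω → ℝ≥0∞ := fun τ ω => if τ < t then ((∑ i, X.queue τ ω i : ℕ) : ℝ≥0∞)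
      else (X.residual t τ ω : ℝ≥0∞)
  have hm : ∀ τ, Measurable (B τ) := fun τ => by
    simp only [B]
    split_ifs with h
    · exact (measurable_of_countable fun q : Fin N → ℕ => ((∑ i, q i : ℕ) : ℝ≥0∞)).comp
        (X.measurable_queue τ)
    · exact (measurable_of_countable fun n : ℕ => (n : ℝ≥0∞)).comp
        (X.measurable_of_factorsThrough (X.residual_factorsThrough (not_lt.1 h)))
  calc _ ≤ ∑ s ∈ Finset.range t, ∫⁻ ω, ∑ i,
        ∑ n ∈ Finset.Ico (X.entered s ω i) (X.entered (s + 1) ω i), X.delay i n ω ∂P :=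
        Finset.sum_le_sum fun s _ => sum_lintegral_le_lintegral_sum _ _
    _ ≤ ∫⁻ ω, ∑ s ∈ Finset.range t, ∑ i,
        ∑ n ∈ Finset.Ico (X.entered s ω i) (X.entered (s + 1) ω i), X.delay i n ω ∂P :=
        sum_lintegral_le_lintegral_sum _ _
    _ ≤ ∫⁻ ω, ∑' τ : ℕ, B τ ω ∂P := lintegral_mono fun ω => X.sum_delay_le t ω
    _ = ∑' τ : ℕ, ∫⁻ ω, B τ ω ∂P := lintegral_tsum fun τ => (hm τ).aemeasurable
    _ = _ := by
        rw [← ENNReal.summable.sum_add_tsum_nat_add' (f := fun τ => ∫⁻ ω, B τ ω ∂P) (k := t)]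
        congr 1
        · refine Finset.sum_congr rfl fun τ hτ => ?_
          simp only [B, Finset.mem_range.1 hτ, if_true, Nat.cast_sum]
        · refine tsum_congr fun k => ?_
          have : ¬ t + k < t := by omega
          simp only [B, this, if_false, add_comm k t]

theorem lintegral_arr [IsProbabilityMeasure P] (X : OnOffSystem P p lam) (t : ℕ) (i : Fin N) :
    ∫⁻ ω, (X.arr t ω i : ℝ≥0∞) ∂P = ENNReal.ofReal (lam i) := by
  rw [← X.integral_arr_apply t i, ofReal_integral_eq_lintegral_ofReal
    (X.integrable_arr_apply t i) (ae_of_all _ fun ω => Nat.cast_nonneg _)]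
  simp

/-- A form of Little's theorem for LCQ. -/
theorem IsDriftFunction.avgDelay_le [IsProbabilityMeasure P] {X : OnOffSystem P p lam}
    {Ψ : (Fin N → ℕ) → ℝ} {g : (Fin N → ℕ) → (Fin N → ℕ) → ℝ} {η L : ℝ}
    (h : X.IsDriftFunction Ψ g η L) (hX : X.IsLCQ) (hN : 0 < N) (hlam : 0 < ∑ i, lam i)
    {a b : ℝ≥0∞} (ha : a ≠ ∞) (hb : b ≠ ∞) (hab : ∀ t : ℕ, ∑ τ ∈ Finset.range t,
      ∫⁻ ω, ∑ i, (X.queue τ ω i : ℝ≥0∞) ∂P ≤ a + t * b) :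
    X.avgDelay ≤ b / ENNReal.ofReal (∑ i, lam i) := by
  set l := ENNReal.ofReal (∑ i, lam i) with hl
  have hl0 : l ≠ 0 := by simpa [hl] using hlam
  have hlt : l ≠ ∞ := ENNReal.ofReal_ne_top
  have hden : ∀ t : ℕ, ∑ s ∈ Finset.range t, ∑ i, ∫⁻ ω, (X.arr s ω i : ℝ≥0∞) ∂P = t * l := by
    intro t
    simp only [X.lintegral_arr]
    rw [← ENNReal.ofReal_sum_of_nonneg fun i _ => X.lam_nonneg i, Finset.sum_const,
      Finset.card_range, nsmul_eq_mul]
  have hform : X.avgDelay = limsup (fun t : ℕ => ((∑ s ∈ Finset.range t, ∑ i, ∫⁻ ω,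
      ∑ n ∈ Finset.Ico (X.entered s ω i) (X.entered (s + 1) ω i), X.delay i n ω ∂P) / l) /
        (t : ℝ≥0∞)) atTop := by
    unfold avgDelay
    congr 1
    ext t
    rw [hden, ENNReal.div_eq_inv_mul, ENNReal.mul_inv (Or.inr hlt) (Or.inr hl0)]
    simp only [div_eq_mul_inv]
    ring
  rw [hform]
  set S := fun t : ℕ => ∫⁻ ω, ENNReal.ofReal (Ψ (X.queue t ω) ^ 2) ∂P with hS
  have hlim := h.tendsto_sq_div hX hN ha hb hab
  -- The error term collects the constant `a` and the sojourn after slot t; the latter is o(t)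
  -- because the second moment of Ψ is.
  refine limsup_div_natCast_le (e := fun t => (a + ENNReal.ofReal (L / η) * S t) / l)
    (fun t => ?_) ?_
  · refine (ENNReal.div_le_div_right ((X.sum_lintegral_delay_le t).trans
      (add_le_add (hab t) (h.tsum_residual_le hX hN t))) l).trans (le_of_eq ?_)
    simp only [div_eq_mul_inv]
    ring
  · have l1 := ENNReal.Tendsto.const_mul hlim
      (Or.inr ENNReal.ofReal_ne_top : (0 : ℝ≥0∞) ≠ 0 ∨ ENNReal.ofReal (L / η) ≠ ∞)
    have l2 := ENNReal.Tendsto.mul_const ((tendsto_const_div_natCast ha).add l1)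
      (Or.inr (ENNReal.inv_ne_top.2 hl0) : (0 + ENNReal.ofReal (L / η) * 0 : ℝ≥0∞) ≠ 0 ∨ l⁻¹ ≠ ∞)
    rw [mul_zero, add_zero, zero_mul] at l2
    refine l2.congr fun t => ?_
    simp only [div_eq_mul_inv]
    ring

end OnOffSystem

/-! ### The capacity region -/

theorem feasibleSet_sum_le_one {N : ℕ} {s m : Fin N → ℕ} (hs : ∀ i, s i ≤ 1)
    (h : m ∈ feasibleSet s) : ∑ i, m i ≤ 1 := by
  rcases h with rfl | ⟨i, rfl⟩
  · simp
  · rw [Finset.sum_pi_single']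
    simpa using hs i

theorem sum_range_natCast (t : ℕ) : ∑ τ ∈ Finset.range t, (τ : ℝ) = t * (t - 1) / 2 := by
  induction t with
  | zero => simp
  | succ t ih => rw [Finset.sum_range_succ, ih]; push_cast; ring

namespace OnOffSystem

variable {Ω : Type*} [MeasurableSpace Ω] {P : Measure Ω} {N : ℕ} {p lam : Fin N → ℝ}

theorem sum_arr_le (X : OnOffSystem P p lam) (t : ℕ) (ω : Ω) :
    ∑ τ ∈ Finset.range t, ∑ i, X.arr τ ω i ≤ (∑ i, X.queue t ω i) + t := by
  have h1 : ∑ i, X.departed t ω i ≤ t := by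
    unfold departed
    rw [Finset.sum_comm]
    calc _ ≤ ∑ _τ ∈ Finset.range t, 1 := Finset.sum_le_sum fun τ _ =>
          (Finset.sum_le_sum fun i _ => min_le_left _ _).trans
            (feasibleSet_sum_le_one (X.chan_le_one τ ω) (X.mu_feasible τ ω))
      _ = t := by simp
  have h2 : ∑ i, (X.queue t ω i + X.departed t ω i) = ∑ i, X.entered t ω i :=
    Finset.sum_congr rfl fun i _ => X.queue_add_departed t ω i
  have h3 : ∑ τ ∈ Finset.range t, ∑ i, X.arr τ ω i ≤ ∑ i, X.entered t ω i := by
    rw [Finset.sum_comm]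
    exact Finset.sum_le_sum fun i _ => Nat.le_add_left _ _
  rw [Finset.sum_add_distrib] at h2
  omega

/-- At most one packet leaves per slot, so the mean total backlog at slot t is at least t(∑ λ_i -
1). If ∑ λ_i > 1, the sums of mean backlogs grow quadratically, against the linear growth allowed by
strong stability. -/
theorem StronglyStable.sum_le_one [IsProbabilityMeasure P] {X : OnOffSystem P p lam}
    (h : X.StronglyStable) : ∑ i, lam i ≤ 1 := by
  by_contra! hlam
  have hQm : ∀ t i, Measurable fun ω => (X.queue t ω i : ℝ≥0∞) := fun t i =>
    (measurable_of_countable fun q : Fin N → ℕ => (q i : ℝ≥0∞)).comp (X.measurable_queue t)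
  have hAm : ∀ t i, Measurable fun ω => (X.arr t ω i : ℝ≥0∞) := fun t i =>
    (measurable_of_countable fun q : Fin N → ℕ => (q i : ℝ≥0∞)).comp (X.measurable_arr t)
  have hgrow : ∀ t : ℕ, ENNReal.ofReal (t * (∑ i, lam i - 1)) ≤
      ∑ i, ∫⁻ ω, (X.queue t ω i : ℝ≥0∞) ∂P := by
    intro t
    have h1 : ∑ τ ∈ Finset.range t, ∑ i, ∫⁻ ω, (X.arr τ ω i : ℝ≥0∞) ∂P ≤
        (∑ i, ∫⁻ ω, (X.queue t ω i : ℝ≥0∞) ∂P) + t := by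
      calc _ ≤ ∑ τ ∈ Finset.range t, ∫⁻ ω, ∑ i, (X.arr τ ω i : ℝ≥0∞) ∂P :=
            Finset.sum_le_sum fun τ _ => sum_lintegral_le_lintegral_sum _ _
        _ ≤ ∫⁻ ω, ∑ τ ∈ Finset.range t, ∑ i, (X.arr τ ω i : ℝ≥0∞) ∂P :=
            sum_lintegral_le_lintegral_sum _ _
        _ ≤ ∫⁻ ω, ((∑ i, (X.queue t ω i : ℝ≥0∞)) + t) ∂P := by
            refine lintegral_mono fun ω => ?_
            have := (Nat.cast_le (α := ℝ≥0∞)).2 (X.sum_arr_le t ω)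
            push_cast at this
            exact this
        _ = _ := by
            rw [lintegral_add_right _ measurable_const, lintegral_finsetSum _ fun i _ => hQm t i]
            simp
    simp only [X.lintegral_arr] at h1
    rw [← ENNReal.ofReal_sum_of_nonneg fun i _ => X.lam_nonneg i, Finset.sum_const,
      Finset.card_range, nsmul_eq_mul] at h1
    rw [mul_sub, mul_one, ENNReal.ofReal_sub _ (Nat.cast_nonneg t),
      ENNReal.ofReal_mul (Nat.cast_nonneg t), ENNReal.ofReal_natCast]
    exact tsub_le_iff_right.2 h1
  choose B hB1 hB2 using fun i => ENNReal.lt_iff_exists_nnreal_btwn.1 (h i)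
  have hev : ∀ᶠ t : ℕ in atTop, ∀ i, (∑ τ ∈ Finset.range t,
      ∫⁻ ω, (X.queue τ ω i : ℝ≥0∞) ∂P) / (t : ℝ≥0∞) < B i :=
    eventually_all.2 fun i => eventually_lt_of_limsup_lt (hB1 i)
  -- Beyond this slot (∑ λ_i - 1) t(t - 1)/2 exceeds t ∑ B_i.
  obtain ⟨n₀, hn₀⟩ := exists_nat_gt (2 * (∑ i, (B i : ℝ)) / (∑ i, lam i - 1) + 1)
  obtain ⟨t, ht, htn, ht1⟩ :=
    (hev.and ((eventually_ge_atTop n₀).and (eventually_ge_atTop 1))).exists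
  have ht0 : (t : ℝ≥0∞) ≠ 0 := by exact_mod_cast (by omega : t ≠ 0)
  have hup : ∑ i, ∑ τ ∈ Finset.range t, ∫⁻ ω, (X.queue τ ω i : ℝ≥0∞) ∂P ≤
      ENNReal.ofReal ((∑ i, (B i : ℝ)) * t) := by
    rw [ENNReal.ofReal_mul (by positivity), ENNReal.ofReal_natCast,
      ENNReal.ofReal_sum_of_nonneg fun i _ => (B i).coe_nonneg, Finset.sum_mul]
    refine Finset.sum_le_sum fun i _ => ?_
    rw [ENNReal.ofReal_coe_nnreal]
    exact (ENNReal.div_le_iff ht0 (ENNReal.natCast_ne_top t)).1 (ht i).le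
  have hlow : ENNReal.ofReal ((∑ i, lam i - 1) * (t * (t - 1) / 2)) ≤
      ∑ i, ∑ τ ∈ Finset.range t, ∫⁻ ω, (X.queue τ ω i : ℝ≥0∞) ∂P := by
    rw [Finset.sum_comm, ← sum_range_natCast, Finset.mul_sum, ENNReal.ofReal_sum_of_nonneg
      fun τ _ => mul_nonneg (by linarith) (Nat.cast_nonneg τ)]
    refine Finset.sum_le_sum fun τ _ => ?_
    rw [mul_comm]
    exact hgrow τ
  have hfin := (ENNReal.ofReal_le_ofReal_iff (by positivity)).1 (hlow.trans hup)
  have htr : (1 : ℝ) ≤ t := by exact_mod_cast ht1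
  have hc : 0 < ∑ i, lam i - 1 := by linarith
  have h4 : 2 * (∑ i, (B i : ℝ)) / (∑ i, lam i - 1) < t - 1 := by
    have : (n₀ : ℝ) ≤ t := by exact_mod_cast htn
    linarith
  rw [div_lt_iff₀ hc] at h4
  nlinarith

end OnOffSystem

theorem capacityRegion_subset {N : ℕ} (p : Fin N → ℝ) :
    capacityRegion p ⊆ {lam | ∑ i, lam i ≤ 1} := by
  refine closure_minimal ?_ (isClosed_le (by fun_prop) continuous_const)
  rintro lam ⟨Ω, _, P, _, X, hX⟩
  exact hX.sum_le_one

theorem sum_le_of_mem_smul_capacityRegion {N : ℕ} {p lam : Fin N → ℝ} {ρ : ℝ} (hρ : 0 ≤ ρ)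
    (h : lam ∈ ρ • capacityRegion p) : ∑ i, lam i ≤ ρ := by
  obtain ⟨x, hx, rfl⟩ := h
  have := capacityRegion_subset p hx
  simp only [Set.mem_ofPred_eq] at this
  simp only [Pi.smul_apply, smul_eq_mul, ← Finset.mul_sum]
  exact mul_le_of_le_one_right hρ this

/-! ### The group number -/

theorem IsGroupNumber.one_le {N : ℕ} {p : Fin N → ℝ} {ρ : ℝ} {K : ℕ} (h : IsGroupNumber p ρ K)
    (hρ : 0 < ρ) : 1 ≤ K := by
  by_contra! hK
  have h1 := h.1
  have : K = 0 := by omega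
  simp only [this, Set.mem_ofPred_eq, pow_zero] at h1
  linarith

/-- By minimality K - 1 fails the condition, so (1 - ρ)/2 < (1 - p_min)^(K-1) ≤ exp(-p_min (K - 1));
take logarithms. -/
theorem IsGroupNumber.le_log {N : ℕ} {p : Fin N → ℝ} {ρ p₀ : ℝ} {K : ℕ}
    (h : IsGroupNumber p ρ K) (hρ : ρ < 1) (hp₀ : 0 < p₀) (hp : p₀ ≤ pMin p)
    (hp1 : pMin p ≤ 1) (hK : 1 ≤ K) : (K : ℝ) ≤ 1 + (Real.log 2 + Real.log (1 / (1 - ρ))) / p₀ := by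
  obtain ⟨k, rfl⟩ := Nat.exists_eq_add_of_le' hK
  have hk : ¬ (1 + ρ) / 2 ≤ 1 - (1 - pMin p) ^ k := fun hk => by
    have := h.2 hk
    omega
  have h1 : (1 - pMin p) ^ k ≤ Real.exp (-(pMin p * k)) := by
    calc (1 - pMin p) ^ k ≤ Real.exp (-pMin p) ^ k :=
          pow_le_pow_left₀ (by linarith) (Real.one_sub_le_exp_neg _) k
      _ = _ := by rw [← Real.exp_nat_mul]; congr 1; ring
  have h2 : (1 - ρ) / 2 < Real.exp (-(pMin p * k)) := by linarith
  have h3 := (Real.log_lt_log (by linarith) h2).le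
  rw [Real.log_exp, Real.log_div (by linarith) (by norm_num)] at h3
  rw [one_div, Real.log_inv]
  push_cast
  have h4 : p₀ * k ≤ pMin p * k := mul_le_mul_of_nonneg_right hp (Nat.cast_nonneg k)
  have h5 : (k : ℝ) ≤ (Real.log 2 + -Real.log (1 - ρ)) / p₀ := by
    rw [le_div_iff₀ hp₀]; linarith
  linarith

/-! ### Second moments -/

/-- In the second factorial moment the factor n(n - 1) cancels against n!, and a shift of the index
by 2 leaves r² times the total mass. -/
theorem integral_mul_sub_one_poissonMeasure (r : NNReal) :
    ∫ n : ℕ, (n : ℝ) * (n - 1) ∂(poissonMeasure r) = (r : ℝ) ^ 2 := by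
  rw [integral_poissonMeasure]
  have h := (hasSum_one_poissonMeasure r).mul_left ((r : ℝ) ^ 2)
  refine HasSum.tsum_eq ?_
  rw [← hasSum_nat_add_iff' 2]
  simp only [Finset.sum_range_succ, Finset.sum_range_zero]
  norm_num
  rw [mul_one] at h
  refine h.congr_fun fun n => ?_
  have h2 : (((n + 2).factorial : ℕ) : ℝ) = (n + 2) * (n + 1) * (n.factorial : ℕ) := by
    rw [Nat.factorial_succ, Nat.factorial_succ]; push_cast; ring
  have h3 : ((n.factorial : ℕ) : ℝ) ≠ 0 := by exact_mod_cast n.factorial_ne_zero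
  rw [h2, pow_add]
  field_simp
  ring

namespace OnOffSystem

variable {Ω : Type*} [MeasurableSpace Ω] {P : Measure Ω} {N : ℕ} {p lam : Fin N → ℝ}

theorem integral_arr_sq_of_poisson [IsProbabilityMeasure P] (X : OnOffSystem P p lam) (i : Fin N)
    (h : P.map (fun ω => X.arr 0 ω i) = poissonMeasure (lam i).toNNReal) :
    ∫ ω, (X.arr 0 ω i : ℝ) ^ 2 ∂P = lam i + lam i ^ 2 := by
  have hm : Measurable fun ω => X.arr 0 ω i := (measurable_pi_apply i).comp (X.measurable_arr 0)
  have h1 : ∫ ω, (X.arr 0 ω i : ℝ) * ((X.arr 0 ω i : ℝ) - 1) ∂P = lam i ^ 2 := by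
    rw [← integral_map (φ := fun ω => X.arr 0 ω i) (f := fun n : ℕ => (n : ℝ) * (n - 1))
      hm.aemeasurable (measurable_of_countable _).aestronglyMeasurable, h,
      integral_mul_sub_one_poissonMeasure, Real.coe_toNNReal _ (X.lam_nonneg i)]
  have h2 : ∀ ω, (X.arr 0 ω i : ℝ) * ((X.arr 0 ω i : ℝ) - 1) =
      (X.arr 0 ω i : ℝ) ^ 2 - (X.arr 0 ω i : ℝ) := fun ω => by ring
  simp only [h2] at h1
  rw [integral_sub (X.memLp_arr i).integrable_sq (X.integrable_arr_apply 0 i), X.mean_arr] at h1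
  linarith

theorem integral_gram_arr [IsProbabilityMeasure P] (X : OnOffSystem P p lam) (z : ℝ) :
    ∫ ω, gram z (castVec (X.arr 0 ω)) (castVec (X.arr 0 ω)) ∂P =
      z * (∑ i, ∫ ω, (X.arr 0 ω i : ℝ) ^ 2 ∂P) +
        (1 - z) * ∫ ω, (∑ i, (X.arr 0 ω i : ℝ)) ^ 2 ∂P := by
  simp only [gram, castVec, ← pow_two]
  rw [integral_add ((integrable_finsetSum _ fun i _ => (X.memLp_arr i).integrable_sq).const_mul z)
    ((X.integrable_sum_arr_sq 0).const_mul _), integral_const_mul, integral_const_mul,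
    integral_finsetSum _ fun i _ => (X.memLp_arr i).integrable_sq]

theorem integral_gram_arr_le [IsProbabilityMeasure P] (X : OnOffSystem P p lam) {z : ℝ}
    (h0 : 0 ≤ z) (h1 : z ≤ 1) :
    ∫ ω, gram z (castVec (X.arr 0 ω)) (castVec (X.arr 0 ω)) ∂P ≤
      ∫ ω, (∑ i, (X.arr 0 ω i : ℝ)) ^ 2 ∂P :=
  integral_mono (X.integrable_gram_arr 0 h0 h1) (X.integrable_sum_arr_sq 0) fun _ =>
    gram_self_le h0 (castVec_nonneg _)

/-! ### Backlog and delay of LCQ -/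

/-- By `zConst_div_add` the λ_tot terms combine to λ_tot / K. The slack 1/2 arises from r_K - λ_tot
≥ (1 + ρ)/2 - ρ = (1 - ρ)/2, of which the imbalance uses up zβ(1 - ρ). -/
theorem IsBalanced.weight_add_le {ρ β : ℝ} {K : ℕ} (hK : 1 ≤ K) (hN : K ≤ N)
    (hgroup : (1 + ρ) / 2 ≤ 1 - (1 - pMin p) ^ K) (hload : ∑ i, lam i ≤ ρ)
    (hbal : IsBalanced lam ρ K β) (i : Fin N) :
    zConst N K * lam i + (1 - zConst N K) * ∑ j, lam j +
      (1 - ρ) * (1 / 2 - zConst N K * β) / K ≤ (1 - (1 - pMin p) ^ K) / K := by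
  have hK0 : (0 : ℝ) < K := by exact_mod_cast hK
  have h1 := mul_le_mul_of_nonneg_left (hbal i) (zConst_nonneg hK hN)
  have h2 : zConst N K * ((∑ j, lam j) / hatN N K + β * (1 - ρ) / K) +
      (1 - zConst N K) * ∑ j, lam j + (1 - ρ) * (1 / 2 - zConst N K * β) / K =
      ((∑ j, lam j) + (1 - ρ) / 2) / K := by
    have : zConst N K * ((∑ j, lam j) / hatN N K) + (1 - zConst N K) * ∑ j, lam j =
        (∑ j, lam j) * (1 / K) := by
      rw [← zConst_div_add hK hN]; ring
    rw [mul_add]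
    linear_combination this
  calc _ ≤ ((∑ j, lam j) + (1 - ρ) / 2) / K := by linarith
    _ ≤ _ := by gcongr; linarith

/-- The common core of both explicit bounds. The parameter κ, a lower bound for the weights z λ_i +
(1 - z) λ_tot, is left free: the larger it is, the smaller the constant `C` can be. -/
theorem avgBacklog_le_and_avgDelay_le [IsProbabilityMeasure P] (X : OnOffSystem P p lam)
    (hX : X.IsLCQ) {ρ β κ C : ℝ} {K : ℕ} (hρ0 : 0 < ρ) (hρ1 : ρ < 1)
    (hmem : lam ∈ ρ • capacityRegion p) (hgroup : IsGroupNumber p ρ K) (hKN : K ≤ N)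
    (hzβ : zConst N K * β < 1 / 2) (hbal : IsBalanced lam ρ K β) (hκ1 : κ ≤ 1)
    (hκ : ∀ i, κ ≤ zConst N K * lam i + (1 - zConst N K) * ∑ j, lam j)
    (hC : (1 / 2 - κ) * (∑ i, lam i) + 1 / 2 *
      ∫ ω, gram (zConst N K) (castVec (X.arr 0 ω)) (castVec (X.arr 0 ω)) ∂P ≤ C) :
    X.avgBacklog ≤ ENNReal.ofReal (C / ((1 - ρ) * (1 / 2 - zConst N K * β) / K)) ∧
    (0 < ∑ i, lam i → X.avgDelay ≤
      ENNReal.ofReal (C / ((1 - ρ) * (1 / 2 - zConst N K * β) / K) / ∑ i, lam i)) := by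
  have hK := hgroup.one_le hρ0
  have hK0 : (0 : ℝ) < K := by exact_mod_cast hK
  have hload := sum_le_of_mem_smul_capacityRegion hρ0.le hmem
  have hz0 := zConst_nonneg hK hKN
  have hz1 := zConst_le_one hK hKN
  have hN : 0 < N := by omega
  have hε : 0 < (1 - ρ) * (1 / 2 - zConst N K * β) / K :=
    div_pos (mul_pos (by linarith) (by linarith)) hK0
  have hlam := IsBalanced.weight_add_le hK hKN hgroup.1 hload hbal
  have hr := X.le_integral_servedWeight hK hKN
  -- With p_min = 0 the group condition would read (1 + ρ)/2 ≤ 0.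
  have hp : 0 < pMin p := by
    rcases X.pMin_nonneg.lt_or_eq with h | h
    · exact h
    · have h1 := hgroup.1
      simp only [← h, Set.mem_ofPred_eq, sub_zero, one_pow] at h1
      linarith
  set ε := (1 - ρ) * (1 / 2 - zConst N K * β) / K
  obtain ⟨a, ha, hab⟩ := X.sum_lintegral_queue_le hX hN hz0 hz1 hκ1 hκ hε hlam hr rfl
  have hab' : ∀ t : ℕ, ∑ τ ∈ Finset.range t, ∫⁻ ω, ∑ i, (X.queue τ ω i : ℝ≥0∞) ∂P ≤
      a + t * ENNReal.ofReal (C / ε) := fun t => (hab t).trans (by gcongr)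
  refine ⟨limsup_div_natCast_le (e := fun _ => a) hab' (tendsto_const_div_natCast ha),
    fun hpos => ?_⟩
  obtain ⟨Ψ, g, η, L, hΨ⟩ := X.exists_isDriftFunction hz0 hz1 hε hlam hr (by linarith) hp
  rw [ENNReal.ofReal_div_of_pos hpos]
  exact hΨ.avgDelay_le hX hN hpos ha ENNReal.ofReal_ne_top hab'

/-- The choice κ = 0 is always admissible, and the form of the arrivals is at most A_tot², so that
`C` can be taken to be D. -/
theorem balanced_bounds [IsProbabilityMeasure P] (X : OnOffSystem P p lam)
    (hX : X.IsLCQ) {ρ β : ℝ} {K : ℕ} (hρ0 : 0 < ρ) (hρ1 : ρ < 1)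
    (hmem : lam ∈ ρ • capacityRegion p) (hgroup : IsGroupNumber p ρ K) (hKN : K ≤ N)
    (hzβ : zConst N K * β < 1 / 2) (hbal : IsBalanced lam ρ K β) :
    X.avgBacklog ≤ ENNReal.ofReal (K * X.constD / ((1 - ρ) * (1 / 2 - zConst N K * β))) ∧
    (0 < ∑ i, lam i → X.avgDelay ≤ ENNReal.ofReal
      (K * (X.constD / ∑ i, lam i) / ((1 - ρ) * (1 / 2 - zConst N K * β)))) := by
  have hK := hgroup.one_le hρ0
  have hz0 := zConst_nonneg hK hKN
  have hz1 := zConst_le_one hK hKN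
  have hl0 : 0 ≤ ∑ i, lam i := Finset.sum_nonneg fun i _ => X.lam_nonneg i
  obtain ⟨h1, h2⟩ := X.avgBacklog_le_and_avgDelay_le hX (κ := 0) (C := X.constD) hρ0 hρ1 hmem
    hgroup hKN hzβ hbal zero_le_one
    (fun i => add_nonneg (mul_nonneg hz0 (X.lam_nonneg i)) (mul_nonneg (by linarith) hl0))
    (by unfold constD; linarith [X.integral_gram_arr_le hz0 hz1])
  have e1 : X.constD / ((1 - ρ) * (1 / 2 - zConst N K * β) / K) =
      K * X.constD / ((1 - ρ) * (1 / 2 - zConst N K * β)) := by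
    rw [div_div_eq_mul_div, mul_comm]
  refine ⟨e1 ▸ h1, fun hpos => ?_⟩
  have e2 : K * (X.constD / ∑ i, lam i) / ((1 - ρ) * (1 / 2 - zConst N K * β)) =
      X.constD / ((1 - ρ) * (1 / 2 - zConst N K * β) / K) / ∑ i, lam i := by
    rw [e1, ← mul_div_assoc, div_right_comm]
  exact e2 ▸ h2 hpos

/-- With equal rates and `hatN N K = N` every weight equals λ_tot / K, so κ = λ_tot / K is the best
choice. The Poisson second moments then give C = λ_tot - λ_tot² / (2K). -/
theorem symmetric_poisson_bounds [IsProbabilityMeasure P] (X : OnOffSystem P p lam)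
    (hX : X.IsLCQ) {ρ : ℝ} {K : ℕ} (hρ0 : 0 < ρ) (hρ1 : ρ < 1)
    (hmem : lam ∈ ρ • capacityRegion p) (hgroup : IsGroupNumber p ρ K) (hKN : K ≤ N)
    (hdvd : K ∣ N) (hsymm : ∀ i, lam i = (∑ j, lam j) / N)
    (hpoisson : ∀ i, P.map (fun ω => X.arr 0 ω i) = poissonMeasure (lam i).toNNReal) :
    IsBalanced lam ρ K 0 ∧
    X.avgBacklog ≤ ENNReal.ofReal
      ((2 * K * (∑ i, lam i) - (∑ i, lam i) ^ 2) / (1 - ρ)) ∧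
    (0 < ∑ i, lam i → X.avgDelay ≤ ENNReal.ofReal ((2 * K - ∑ i, lam i) / (1 - ρ))) := by
  have hK := hgroup.one_le hρ0
  have hK0 : (0 : ℝ) < K := by exact_mod_cast hK
  have hN0 : (0 : ℝ) < N := by exact_mod_cast (by omega : 0 < N)
  have hz0 := zConst_nonneg hK hKN
  have hz1 := zConst_le_one hK hKN
  have hload := sum_le_of_mem_smul_capacityRegion hρ0.le hmem
  have hhat : hatN N K = N := hatN_of_dvd hK hdvd
  have hbal : IsBalanced lam ρ K 0 := fun i => by
    rw [hhat, hsymm i]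
    simp only [zero_mul, zero_div, add_zero]
    rw [← hsymm i]
  have hz := zConst_div_add hK hKN
  rw [hhat] at hz
  set l := ∑ i, lam i with hl
  have hw : ∀ i, zConst N K * lam i + (1 - zConst N K) * l = l / K := fun i => by
    rw [hsymm i, div_eq_mul_one_div l (K : ℝ), ← hz]; ring
  have hsq : ∑ i, lam i ^ 2 = l ^ 2 / N := by
    rw [Finset.sum_congr rfl fun i _ => by rw [hsymm i], Finset.sum_const, Finset.card_univ,
      Fintype.card_fin, nsmul_eq_mul]
    field_simp
  have hA : ∑ i, ∫ ω, (X.arr 0 ω i : ℝ) ^ 2 ∂P = l + l ^ 2 / N := by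
    rw [Finset.sum_congr rfl fun i _ => X.integral_arr_sq_of_poisson i (hpoisson i),
      Finset.sum_add_distrib, hsq]
  have hC : (1 / 2 - l / K) * l + 1 / 2 *
      ∫ ω, gram (zConst N K) (castVec (X.arr 0 ω)) (castVec (X.arr 0 ω)) ∂P =
      l - l ^ 2 / (2 * K) := by
    rw [X.integral_gram_arr, X.integral_sum_arr_sq, hA, hsq, ← hl]
    have : zConst N K * (l ^ 2 / N) + (1 - zConst N K) * l ^ 2 = l ^ 2 / K := by
      rw [div_eq_mul_one_div (l ^ 2) (K : ℝ), ← hz]; ring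
    have h3 : l / K * l = l ^ 2 / K := by ring
    have h4 : l ^ 2 / (2 * K) = l ^ 2 / K / 2 := by field_simp
    rw [h4]
    linear_combination 1 / 2 * this - h3
  obtain ⟨h1, h2⟩ := X.avgBacklog_le_and_avgDelay_le hX (κ := l / K) hρ0 hρ1 hmem hgroup hKN
    (by norm_num) hbal
    (by
      rw [div_le_one hK0]
      have : (1 : ℝ) ≤ K := by exact_mod_cast hK
      linarith)
    (fun i => (hw i).ge) hC.le
  have hρ' : (1 - ρ) ≠ 0 := by linarith
  have e1 : (l - l ^ 2 / (2 * K)) / ((1 - ρ) * (1 / 2 - zConst N K * 0) / K) =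
      (2 * K * l - l ^ 2) / (1 - ρ) := by
    rw [mul_zero, sub_zero]
    field_simp
  refine ⟨hbal, e1 ▸ h1, fun hpos => ?_⟩
  have e2 : (2 * K - l) / (1 - ρ) =
      (l - l ^ 2 / (2 * K)) / ((1 - ρ) * (1 / 2 - zConst N K * 0) / K) / l := by
    rw [e1]
    field_simp
  exact e2 ▸ h2 hpos

/-- By independence over links the products of arrivals to different links add at most λ_tot² ≤
λ_tot to the second moment of A_tot. -/
theorem constD_div_le [IsProbabilityMeasure P] (X : OnOffSystem P p lam) {M : ℝ}
    (hpos : 0 < ∑ i, lam i) (hload : ∑ i, lam i ≤ 1)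
    (hM : ∑ i, ∫ ω, (X.arr 0 ω i : ℝ) ^ 2 ∂P ≤ M * ∑ i, lam i) :
    X.constD / ∑ i, lam i ≤ (M + 2) / 2 := by
  have h1 : 0 ≤ ∑ i, lam i ^ 2 := Finset.sum_nonneg fun i _ => sq_nonneg _
  rw [div_le_iff₀ hpos, constD, X.integral_sum_arr_sq]
  nlinarith

end OnOffSystem

/-! ### The theorem and its uniform constant -/

theorem mainTheorem2 :
    (∀ (Ω : Type u) [MeasurableSpace Ω] (P : Measure Ω) [IsProbabilityMeasure P]
      (N : ℕ) (p lam : Fin N → ℝ) (X : OnOffSystem P p lam) (ρ : ℝ) (K : ℕ),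
      X.IsLCQ → 0 < ρ → ρ < 1 → lam ∈ ρ • capacityRegion p → IsGroupNumber p ρ K → K ≤ N →
        (∀ β : ℝ, 0 ≤ β → zConst N K * β < 1 / 2 → IsBalanced lam ρ K β →
          X.avgBacklog ≤ ENNReal.ofReal
            (K * X.constD / ((1 - ρ) * (1 / 2 - zConst N K * β))) ∧
          (0 < ∑ i, lam i → X.avgDelay ≤ ENNReal.ofReal
            (K * (X.constD / ∑ i, lam i) / ((1 - ρ) * (1 / 2 - zConst N K * β))))) ∧
        (K ∣ N → (∀ i, lam i = (∑ j, lam j) / N) →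
          (∀ i, P.map (fun ω => X.arr 0 ω i) = poissonMeasure (lam i).toNNReal) →
          IsBalanced lam ρ K 0 ∧
          X.avgBacklog ≤ ENNReal.ofReal
            ((2 * K * (∑ i, lam i) - (∑ i, lam i) ^ 2) / (1 - ρ)) ∧
          (0 < ∑ i, lam i → X.avgDelay ≤ ENNReal.ofReal
            ((2 * K - ∑ i, lam i) / (1 - ρ))))) ∧
    (∀ p₀ ρ₀ δ M : ℝ, 0 < p₀ → 0 < ρ₀ → 0 < δ →
      ∃ c : ℝ, ∀ (Ω : Type u) [MeasurableSpace Ω] (P : Measure Ω) [IsProbabilityMeasure P]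
        (N : ℕ) (p lam : Fin N → ℝ) (X : OnOffSystem P p lam) (ρ : ℝ) (K : ℕ) (β : ℝ),
        X.IsLCQ → ρ₀ ≤ ρ → ρ < 1 → lam ∈ ρ • capacityRegion p → IsGroupNumber p ρ K → K ≤ N →
        0 ≤ β → zConst N K * β ≤ 1 / 2 - δ → IsBalanced lam ρ K β →
        p₀ ≤ pMin p → 0 < ∑ i, lam i →
        ∑ i, ∫ ω, (X.arr 0 ω i : ℝ) ^ 2 ∂P ≤ M * ∑ i, lam i →
          X.avgDelay ≤ ENNReal.ofReal (c * Real.log (1 / (1 - ρ)) / (1 - ρ))) := by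
  refine ⟨fun Ω _ P _ N p lam X ρ K hX hρ0 hρ1 hmem hgroup hKN =>
    ⟨fun β _ hzβ hbal => X.balanced_bounds hX hρ0 hρ1 hmem hgroup hKN hzβ hbal,
      fun hdvd hsymm hpoisson =>
        X.symmetric_poisson_bounds hX hρ0 hρ1 hmem hgroup hKN hdvd hsymm hpoisson⟩,
    fun p₀ ρ₀ δ M hp₀ hρ₀ hδ => ?_⟩
  -- The bound K ≤ 1 + log 2 / p₀ + log(1/(1 - ρ)) / p₀ has a constant part, which is absorbed using
  -- log(1/(1 - ρ)) ≥ log(1/(1 - ρ₀)) > 0. The factors (M + 2)/2 and 1/δ bound D / λ_tot and 1/(1/2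
  -- - zβ).
  refine ⟨((1 + Real.log 2 / p₀) / Real.log (1 / (1 - ρ₀)) + 1 / p₀) * ((M + 2) / 2) / δ, ?_⟩
  intro Ω _ P _ N p lam X ρ K β hX hρ hρ1 hmem hgroup hKN _ hzβ hbal hp hpos hM
  have hρ0 : 0 < ρ := by linarith
  have hK := hgroup.one_le hρ0
  have hload := sum_le_of_mem_smul_capacityRegion hρ0.le hmem
  refine ((X.balanced_bounds hX hρ0 hρ1 hmem hgroup hKN (by linarith) hbal).2 hpos).trans
    (ENNReal.ofReal_le_ofReal ?_)
  have hD := X.constD_div_le hpos (by linarith) hM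
  have hD0 : 0 ≤ X.constD / ∑ i, lam i := by
    refine div_nonneg ?_ hpos.le
    have : 0 ≤ ∫ ω, (∑ i, (X.arr 0 ω i : ℝ)) ^ 2 ∂P := integral_nonneg fun _ => sq_nonneg _
    unfold OnOffSystem.constD
    linarith
  have hKlog := hgroup.le_log hρ1 hp₀ hp X.pMin_le_one hK
  have hl0 : 0 < Real.log (1 / (1 - ρ₀)) := by
    refine Real.log_pos ?_
    rw [lt_div_iff₀ (by linarith)]
    linarith
  have hl : Real.log (1 / (1 - ρ₀)) ≤ Real.log (1 / (1 - ρ)) := by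
    refine Real.log_le_log (one_div_pos.2 (by linarith)) ?_
    exact one_div_le_one_div_of_le (by linarith) (by linarith)
  set x := Real.log (1 / (1 - ρ))
  set x₀ := Real.log (1 / (1 - ρ₀))
  have hlog2 : 0 < Real.log 2 := Real.log_pos (by norm_num)
  have hKx : (K : ℝ) ≤ ((1 + Real.log 2 / p₀) / x₀ + 1 / p₀) * x := by
    have h1 : 1 + Real.log 2 / p₀ ≤ (1 + Real.log 2 / p₀) / x₀ * x := by
      rw [div_mul_eq_mul_div, le_div_iff₀ hl0]
      exact mul_le_mul_of_nonneg_left hl (by positivity)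
    calc (K : ℝ) ≤ (1 + Real.log 2 / p₀) + 1 / p₀ * x := hKlog.trans (le_of_eq (by ring))
      _ ≤ _ := by rw [add_mul]; linarith
  have h1ρ : 0 < 1 - ρ := by linarith
  calc K * (X.constD / ∑ i, lam i) / ((1 - ρ) * (1 / 2 - zConst N K * β))
      ≤ K * (X.constD / ∑ i, lam i) / ((1 - ρ) * δ) := by
        gcongr
        linarith
    _ ≤ (((1 + Real.log 2 / p₀) / x₀ + 1 / p₀) * x) * ((M + 2) / 2) / ((1 - ρ) * δ) := by
        have : 0 ≤ ((1 + Real.log 2 / p₀) / x₀ + 1 / p₀) * x := (Nat.cast_nonneg K).trans hKx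
        gcongr
    _ = _ := by
        rw [mul_comm (1 - ρ) δ, ← div_div]
        ring
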